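/- **Setting.** Let $\mathcal E$ be a positive Heyting category: it has finite limits, stable image factorisations (cover followed by mono), finite disjoint stable sums, and right adjoints $\forall_f$ to all pullback maps between subobject posets. A *cover* is a map that factors through no proper subobject of its codomain. A commutative square $D\to C\to A$, $D\to B\to A$ is a *quasi-pullback* if $D\to B\times_A C$ is a cover, and it is a *covering square* with left side $D\to B$ and right side $C\to A$ if moreover $B\to A$ is a cover. A class $\mathcal S$ of maps in $\mathcal E$ is a *class of small maps* if: it is stable under pullback; it satisfies descent (a map whose pullback along some cover is in $\mathcal S$ is in $\mathcal S$); it is closed under binary sums of maps and under composition; it contains $0\to1$, $1\to1$ and $1+1\to1$; if $f$ is a cover and $gf\in\mathcal S$ then $g\in\mathcal S$; for each cover $p:Y\to X$ and each $f:X\to A$ in $\mathcal S$ there is a covering square with right side $f$, left side $Z\to B$ in $\mathcal S$, and top side of the form $Z\to Y\xrightarrow{p}X$ (collection); $\forall_f$ preserves monos in $\mathcal S$ whenever $f\in\mathcal S$; and all diagonals $X\to X\times X$ are in $\mathcal S$. The pair $(\mathcal E,\mathcal S)$ is a *predicative category with small maps* if moreover: maps in $\mathcal S$ are exponentiable (pulling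 back along them has a right adjoint between slice categories) and their W-types (initial algebras of the associated polynomial functors) exist; there is a natural numbers object $N$, and $N\to1$ is in $\mathcal S$; there is a map $\pi\in\mathcal S$ such that every map in $\mathcal S$ is the right side of a covering square whose left side is a pullback of $\pi$; and every equivalence relation $R\rightarrowtail X\times X$ given by a mono in $\mathcal S$ has a stable quotient (a map $X\to Q$ such that $R\rightrightarrows X\to Q$ is both a kernel pair and a coequaliser diagram, as are all its pullbacks along maps into $Q$). **Fullness.** Let $\phi:B\to A$ be a map over $X$ and $Y\to X$ any map. A *multi-valued section* (mvs) of $\phi$ over $Y$ is a subobject $P\subseteq Y\times_XB$ such that $P\to Y\times_XA$ is a cover belonging to $\mathcal S$. The fullness axiom **(F)** for $(\mathcal E,\mathcal S)$ says: for all $\phi:B\to A$ and $A\to X$ in $\mathcal S$ there are a cover $q:X'\to X$, a map $y:Y\to X'$ in $\mathcal S$ and an mvs $P$ of $\phi$ over $Y$ such that, for every $z:Z\to X'$ and every mvs $Q$ of $\phi$ over $Z$, there are a map $k:U\to Y$ and a cover $l:U\to Z$ with $yk=zl$ and $k^*P\le l^*Q$ as subobjects of $U\times_XB$. **Theorem.**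 Let $(\mathcal E,\mathcal S)$ be a predicative category with small maps satisfying **(F)**, and let $\mathcal C$ be an internal category in $\mathcal E$ whose codomain map $\mathcal C_1\to\mathcal C_0$ is in $\mathcal S$. Let $\mathrm{Psh}_{\mathcal E}(\mathcal C)$ be the category of internal presheaves on $\mathcal C$, and call a map of presheaves *pointwise small* if its underlying map in $\mathcal E/\mathcal C_0$ (equivalently, in $\mathcal E$) is in $\mathcal S$. 1. If $\mathcal C$ has chosen pullbacks, then $\mathrm{Psh}_{\mathcal E}(\mathcal C)$ with the class of pointwise small maps satisfies **(F)**. 2. If $\mathcal C$ has chosen finite products, then $\mathrm{Psh}_{\mathcal E}(\mathcal C)$ with the class of pointwise small maps satisfies **(F)**. (Chosen pullbacks and chosen finite products are understood internally: given by maps of $\mathcal E$ whose universal property holds for all generalised elements.) -/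

import Mathlib

open CategoryTheory CategoryTheory.Limits

universe v u

set_option linter.unusedSimpArgs false

noncomputable section

namespace SmallMaps

/-! ### Covers, covering squares, positive Heyting categories -/

section General

variable {E : Type u} [Category.{v} E]

/-- A map is a *cover* if the only subobject of its codomain through which it factors is the
maximal one. -/
def IsCover {B A : E} (f : B ⟶ A) : Prop :=
  ∀ ⦃M : E⦄ (m : M ⟶ A) [Mono m] (g : B ⟶ M), g ≫ m = f → IsIso m

variable [HasPullbacks E]

/-- The square with top `d`, left `f`, right `g`, bottom `p` commutes and the comparison map
`D ⟶ B ×_A C` is a cover. -/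
def IsQuasiPullback {D C B A : E} (d : D ⟶ C) (f : D ⟶ B) (g : C ⟶ A) (p : B ⟶ A) : Prop :=
  ∃ h : f ≫ p = d ≫ g, IsCover (pullback.lift f d h)

/-- A quasi-pullback (top `d`, left `f`, right `g`, bottom `p`) whose bottom side is a cover. -/
def IsCoveringSquare {D C B A : E} (d : D ⟶ C) (f : D ⟶ B) (g : C ⟶ A) (p : B ⟶ A) : Prop :=
  IsQuasiPullback d f g p ∧ IsCover p

/-- `N` is the universal quantification `∀_f M` of the subobject `M` of `Y` along `f : Y ⟶ X`. -/
def IsForallAlong {Y X : E} (f : Y ⟶ X) (M : Subobject Y) (N : Subobject X) : Prop :=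
  ∀ K : Subobject X, K ≤ N ↔ (Subobject.pullback f).obj K ≤ M

end General

/-- A positive Heyting category: finite limits and stable image factorisations (a regular
category), disjoint and stable finite sums, and right adjoints `∀_f` to all pullback maps
between subobject posets. -/
class PositiveHeyting (E : Type u) [Category.{v} E] : Prop
    extends Regular E, FinitaryExtensive E where
  exists_forall : ∀ ⦃Y X : E⦄ (f : Y ⟶ X) (M : Subobject Y), ∃ N : Subobject X,
    IsForallAlong f M N

/-! ### Classes of small maps -/

/-- The axioms for a class `S` of small maps in a positive Heyting category. -/
structure IsClassOfSmallMaps {E : Type u} [Category.{v} E] [PositiveHeyting E]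
    (S : MorphismProperty E) : Prop where
  /-- Pullback stability. -/
  pullback_stability : ∀ ⦃D B C A : E⦄ ⦃d : D ⟶ B⦄ ⦃g : D ⟶ C⦄ ⦃f : B ⟶ A⦄ ⦃p : C ⟶ A⦄,
    IsPullback d g f p → S f → S g
  /-- Descent along covers. -/
  descent : ∀ ⦃D B C A : E⦄ ⦃d : D ⟶ B⦄ ⦃g : D ⟶ C⦄ ⦃f : B ⟶ A⦄ ⦃p : C ⟶ A⦄,
    IsPullback d g f p → IsCover p → S g → S f
  /-- Sums. -/
  sums : ∀ ⦃X Y X' Y' : E⦄ (f : X ⟶ Y) (f' : X' ⟶ Y'), S f → S f' → S (coprod.map f f')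
  /-- Finiteness: `0`, `1` and `1 + 1` are small. -/
  empty_small : S (terminal.from (⊥_ E))
  one_small : S (terminal.from (⊤_ E))
  two_small : S (terminal.from ((⊤_ E) ⨿ (⊤_ E)))
  /-- Composition. -/
  composition : ∀ ⦃X Y Z : E⦄ (f : X ⟶ Y) (g : Y ⟶ Z), S f → S g → S (f ≫ g)
  /-- Quotients. -/
  quotients : ∀ ⦃Z Y X : E⦄ (f : Z ⟶ Y) (g : Y ⟶ X), IsCover f → S (f ≫ g) → S g
  /-- Collection: given a cover `p : Y ⟶ X` and a small `f : X ⟶ A`, there is a covering square with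
  top `Z ⟶ Y ⟶ X`, right side `f` and small left side. -/
  collection : ∀ ⦃Y X A : E⦄ (p : Y ⟶ X) (f : X ⟶ A), IsCover p → S f →
    ∃ (Z B : E) (t : Z ⟶ Y) (g : Z ⟶ B) (h : B ⟶ A),
      S g ∧ IsCoveringSquare (t ≫ p) g f h
  /-- Heyting: `∀_f` along a small map `f` sends small monos to small monos. -/
  heyting : ∀ ⦃Y X : E⦄ (f : Y ⟶ X), S f → ∀ (M : Subobject Y) (N : Subobject X),
    IsForallAlong f M N → S M.arrow → S N.arrow
  /-- Diagonals. -/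
  diagonals : ∀ X : E, S (diag X)

/-- `N` with `zero` and `succ` is a natural numbers object. -/
def IsNNO {E : Type u} [Category.{v} E] [HasTerminal E] {N : E} (zero : ⊤_ E ⟶ N)
    (succ : N ⟶ N) : Prop :=
  ∀ ⦃X : E⦄ (a : ⊤_ E ⟶ X) (t : X ⟶ X), ∃! f : N ⟶ X, zero ≫ f = a ∧ succ ≫ f = f ≫ t

/-- `r₁, r₂ : R ⟶ X` exhibit `R` as an equivalence relation on `X`, phrased for generalised
elements. -/
structure IsEquivRel {E : Type u} [Category.{v} E] {R X : E} (r₁ r₂ : R ⟶ X) : Prop where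
  jointly_mono : ∀ ⦃T : E⦄ (s t : T ⟶ R), s ≫ r₁ = t ≫ r₁ → s ≫ r₂ = t ≫ r₂ → s = t
  equivalence : ∀ T : E,
    Equivalence fun a b : T ⟶ X => ∃ t : T ⟶ R, t ≫ r₁ = a ∧ t ≫ r₂ = b

/-- `R ⇉ X ⟶ Q` is exact: both a kernel pair and a coequaliser diagram. -/
def IsExactFork {E : Type u} [Category.{v} E] {R X Q : E} (r₁ r₂ : R ⟶ X) (q : X ⟶ Q) : Prop :=
  IsKernelPair q r₁ r₂ ∧
    ∃ w : r₁ ≫ q = r₂ ≫ q, Nonempty (IsColimit (Cofork.ofπ q w))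

/-- `q : X ⟶ Q` is a *stable quotient* of `r₁, r₂ : R ⇉ X`: the diagram `R ⇉ X ⟶ Q` is exact,
and so is its pullback along every map `p : P ⟶ Q`. -/
def IsStableQuotient {E : Type u} [Category.{v} E] {R X Q : E} (r₁ r₂ : R ⟶ X) (q : X ⟶ Q) :
    Prop :=
  IsExactFork r₁ r₂ q ∧
    ∀ ⦃P X' R' : E⦄ (p : P ⟶ Q) (q' : X' ⟶ P) (x : X' ⟶ X) (r₁' r₂' : R' ⟶ X') (r : R' ⟶ R),
      IsPullback x q' q p → IsPullback r (r₁' ≫ q') (r₁ ≫ q) p →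
      r₁' ≫ q' = r₂' ≫ q' → r₁' ≫ x = r ≫ r₁ → r₂' ≫ x = r ≫ r₂ →
      IsExactFork r₁' r₂' q'

/-- The polynomial functor `Σ_A ∘ Π_f ∘ B^*` of `f : B ⟶ A`, for a right adjoint `Π_f` of the
pullback functor of `f`. -/
abbrev polynomialFunctor {E : Type u} [Category.{v} E] [HasBinaryProducts E]
    {B A : E} (PiF : Over B ⥤ Over A) : E ⥤ E :=
  Over.star B ⋙ PiF ⋙ Over.forget A

/-- `(E, S)` is a predicative category with small maps. -/
structure IsPredicative {E : Type u} [Category.{v} E] [PositiveHeyting E]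
    (S : MorphismProperty E) : Prop extends IsClassOfSmallMaps S where
  /-- Small maps are exponentiable, i.e. pulling back along them has a right adjoint. -/
  piE : ∀ ⦃B A : E⦄ (f : B ⟶ A), S f → (Over.pullback f).IsLeftAdjoint
  /-- W-types (initial algebras of polynomial functors) of small maps exist. -/
  wE : ∀ ⦃B A : E⦄ (f : B ⟶ A), S f → ∀ (PiF : Over B ⥤ Over A),
    Nonempty (Over.pullback f ⊣ PiF) →
      HasInitial (Endofunctor.Algebra (polynomialFunctor PiF))
  /-- A natural numbers object exists. -/
  nE : ∃ (N : E) (zero : ⊤_ E ⟶ N) (succ : N ⟶ N), IsNNO zero succ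
  /-- The natural numbers object is small. -/
  nS : ∀ ⦃N : E⦄ (zero : ⊤_ E ⟶ N) (succ : N ⟶ N), IsNNO zero succ → S (terminal.from N)
  /-- Representability: there is a universal small map `π`; every small map is covered by a pullback
  of `π`. -/
  representability : ∃ (Eu U : E) (π : Eu ⟶ U), S π ∧ ∀ ⦃Y X : E⦄ (f : Y ⟶ X), S f →
    ∃ (B A : E) (b : B ⟶ A) (i : B ⟶ Y) (j : A ⟶ X) (m : B ⟶ Eu) (n : A ⟶ U),
      IsCoveringSquare i b f j ∧ IsPullback m b π n
  /-- Bounded exactness: an equivalence relation given by a small mono has a stable quotient. -/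
  bounded_exactness : ∀ ⦃R X : E⦄ (r₁ r₂ : R ⟶ X), IsEquivRel r₁ r₂ → S (prod.lift r₁ r₂) →
    ∃ (Q : E) (q : X ⟶ Q), IsStableQuotient r₁ r₂ q

/-! ### Fullness -/

section Fullness

variable {D : Type u} [Category.{v} D] [HasPullbacks D]

/-- The map `f^* φ : Y ×_X B ⟶ Y ×_X A`, for `φ : B ⟶ A` and `j : A ⟶ X` (so that `φ` is a map
over `X`) and `f : Y ⟶ X`. -/
def reindexMap {B A X Y : D} (φ : B ⟶ A) (j : A ⟶ X) (f : Y ⟶ X) :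
    pullback f (φ ≫ j) ⟶ pullback f j :=
  pullback.lift (pullback.fst f (φ ≫ j)) (pullback.snd f (φ ≫ j) ≫ φ)
    (by rw [Category.assoc, pullback.condition])

/-- A multi-valued section of `φ : B ⟶ A` over `f : Y ⟶ X`, where `A` lives over `X` via `j`:
a subobject `P` of `Y ×_X B` such that `P ⟶ Y ×_X A` is a small cover. -/
def IsMvs (S : MorphismProperty D) {B A X Y : D} (φ : B ⟶ A) (j : A ⟶ X) (f : Y ⟶ X)
    (P : Subobject (pullback f (φ ≫ j))) : Prop :=
  IsCover (P.arrow ≫ reindexMap φ j f) ∧ S (P.arrow ≫ reindexMap φ j f)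

/-- The map `U ×_X B ⟶ Y ×_X B` induced by a map `k : U ⟶ Y` over `X`. -/
def baseChangeMap {B X Y U : D} (b : B ⟶ X) (f : Y ⟶ X) (k : U ⟶ Y) (g : U ⟶ X)
    (h : k ≫ f = g) : pullback g b ⟶ pullback f b :=
  pullback.lift (pullback.fst g b ≫ k) (pullback.snd g b)
    (by rw [Category.assoc, h, pullback.condition])

/-- The fullness axiom for the class `S`: for `B ⟶ A` and `A ⟶ X` in `S` there are a cover
`q : X' ⟶ X`, a map `y : Y ⟶ X'` in `S` and a multi-valued section `P` of `φ` over `Y` such that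
for every `z : Z ⟶ X'` and every multi-valued section `Q` of `φ` over `Z` there are `k : U ⟶ Y`
and a cover `l : U ⟶ Z` with `y k = z l` and `k^* P ≤ l^* Q`. -/
def Fullness (S : MorphismProperty D) : Prop :=
  ∀ ⦃B A X : D⦄ (φ : B ⟶ A) (j : A ⟶ X), S φ → S j →
    ∃ (X' Y : D) (q : X' ⟶ X) (y : Y ⟶ X') (P : Subobject (pullback (y ≫ q) (φ ≫ j))),
      IsCover q ∧ S y ∧ IsMvs S φ j (y ≫ q) P ∧
      ∀ ⦃Z : D⦄ (z : Z ⟶ X') (Q : Subobject (pullback (z ≫ q) (φ ≫ j))),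
        IsMvs S φ j (z ≫ q) Q →
        ∃ (U : D) (k : U ⟶ Y) (l : U ⟶ Z) (h : k ≫ y = l ≫ z), IsCover l ∧
          (Subobject.pullback (baseChangeMap (φ ≫ j) (y ≫ q) k (l ≫ z ≫ q)
              (by rw [← Category.assoc, h, Category.assoc]))).obj P ≤
            (Subobject.pullback (baseChangeMap (φ ≫ j) (z ≫ q) l (l ≫ z ≫ q) rfl)).obj Q

end Fullness

/-! ### Internal categories -/

/-- An internal category in `E`. The map `comp` sends a pair `(f, g)` with `dom f = cod g` to the
composite `f ∘ g`. Associativity and unit laws are phrased for generalised elements. -/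
structure InternalCategory (E : Type u) [Category.{v} E] [HasPullbacks E] where
  Ob : E
  Arr : E
  dom : Arr ⟶ Ob
  cod : Arr ⟶ Ob
  ident : Ob ⟶ Arr
  comp : pullback dom cod ⟶ Arr
  ident_dom : ident ≫ dom = 𝟙 Ob
  ident_cod : ident ≫ cod = 𝟙 Ob
  comp_dom : comp ≫ dom = pullback.snd dom cod ≫ dom
  comp_cod : comp ≫ cod = pullback.fst dom cod ≫ cod
  id_comp : ∀ ⦃T : E⦄ (f : T ⟶ Arr),
    pullback.lift (f ≫ cod ≫ ident) f (by simp [ident_dom]) ≫ comp = f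
  comp_id : ∀ ⦃T : E⦄ (f : T ⟶ Arr),
    pullback.lift f (f ≫ dom ≫ ident) (by simp [ident_cod]) ≫ comp = f
  assoc : ∀ ⦃T : E⦄ (f g k : T ⟶ Arr) (h₁ : f ≫ dom = g ≫ cod) (h₂ : g ≫ dom = k ≫ cod),
    pullback.lift (pullback.lift f g h₁ ≫ comp) k (by rw [Category.assoc, comp_dom, pullback.lift_snd_assoc, h₂]) ≫ comp =
      pullback.lift f (pullback.lift g k h₂ ≫ comp) (by rw [Category.assoc, comp_cod, pullback.lift_fst_assoc, h₁]) ≫ comp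

namespace InternalCategory

variable {E : Type u} [Category.{v} E]

section

variable [HasPullbacks E] (C : InternalCategory E)

/-- The composite `f ∘ g` of generalised arrows. -/
def compose {T : E} (f g : T ⟶ C.Arr) (h : f ≫ C.dom = g ≫ C.cod) : T ⟶ C.Arr :=
  pullback.lift f g h ≫ C.comp

/-- A choice of pullbacks in an internal category: the object of cospans `c → e ← d` carries maps
`p` and `q` to the object of arrows, giving the two projections of a pullback of the cospan; the
universal property is phrased for generalised elements. -/
structure ChosenPullbacks where
  p : pullback C.cod C.cod ⟶ C.Arr
  q : pullback C.cod C.cod ⟶ C.Arr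
  p_cod : p ≫ C.cod = pullback.fst C.cod C.cod ≫ C.dom
  q_cod : q ≫ C.cod = pullback.snd C.cod C.cod ≫ C.dom
  dom_eq : p ≫ C.dom = q ≫ C.dom
  square : C.compose (pullback.fst C.cod C.cod) p p_cod.symm =
    C.compose (pullback.snd C.cod C.cod) q q_cod.symm
  universal : ∀ ⦃T : E⦄ (w : T ⟶ pullback C.cod C.cod) (a b : T ⟶ C.Arr)
    (ha : (w ≫ pullback.fst C.cod C.cod) ≫ C.dom = a ≫ C.cod)
    (hb : (w ≫ pullback.snd C.cod C.cod) ≫ C.dom = b ≫ C.cod),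
    a ≫ C.dom = b ≫ C.dom →
    C.compose (w ≫ pullback.fst C.cod C.cod) a ha =
      C.compose (w ≫ pullback.snd C.cod C.cod) b hb →
    ∃! t : T ⟶ C.Arr,
      (∃ h : (w ≫ p) ≫ C.dom = t ≫ C.cod, C.compose (w ≫ p) t h = a) ∧
      (∃ h : (w ≫ q) ≫ C.dom = t ≫ C.cod, C.compose (w ≫ q) t h = b)

end

section

variable [HasFiniteLimits E] (C : InternalCategory E)

/-- A choice of finite products in an internal category: a terminal object `one`, and maps `p`,
`q` sending a pair of objects `(c, d)` to the two projections of a product of `c` and `d`; the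
universal properties are phrased for generalised elements. -/
structure ChosenFiniteProducts where
  one : ⊤_ E ⟶ C.Ob
  one_universal : ∀ ⦃T : E⦄ (a : T ⟶ C.Ob),
    ∃! t : T ⟶ C.Arr, t ≫ C.dom = a ∧ t ≫ C.cod = terminal.from T ≫ one
  p : C.Ob ⨯ C.Ob ⟶ C.Arr
  q : C.Ob ⨯ C.Ob ⟶ C.Arr
  p_cod : p ≫ C.cod = prod.fst
  q_cod : q ≫ C.cod = prod.snd
  dom_eq : p ≫ C.dom = q ≫ C.dom
  universal : ∀ ⦃T : E⦄ (w : T ⟶ C.Ob ⨯ C.Ob) (a b : T ⟶ C.Arr),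
    a ≫ C.cod = w ≫ prod.fst → b ≫ C.cod = w ≫ prod.snd → a ≫ C.dom = b ≫ C.dom →
    ∃! t : T ⟶ C.Arr,
      (∃ h : (w ≫ p) ≫ C.dom = t ≫ C.cod, C.compose (w ≫ p) t h = a) ∧
      (∃ h : (w ≫ q) ≫ C.dom = t ≫ C.cod, C.compose (w ≫ q) t h = b)

end

end InternalCategory

/-! ### Internal presheaves -/

/-- An internal presheaf on `C`: an object `X` over the object of objects with a restriction map
sending `(x, f)` with `proj x = cod f` to `x · f`, such that `proj (x · f) = dom f`, `x · id = x`
and `(x · f) · g = x · (f ∘ g)`. -/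
structure InternalPresheaf {E : Type u} [Category.{v} E] [HasPullbacks E]
    (C : InternalCategory E) where
  X : E
  proj : X ⟶ C.Ob
  act : pullback proj C.cod ⟶ X
  act_proj : act ≫ proj = pullback.snd proj C.cod ≫ C.dom
  act_id : pullback.lift (𝟙 X) (proj ≫ C.ident) (by simp [C.ident_cod]) ≫ act = 𝟙 X
  act_comp : ∀ ⦃T : E⦄ (x : T ⟶ X) (f g : T ⟶ C.Arr) (h₁ : x ≫ proj = f ≫ C.cod)
    (h₂ : f ≫ C.dom = g ≫ C.cod),
    pullback.lift (pullback.lift x f h₁ ≫ act) g (by rw [Category.assoc, act_proj, pullback.lift_snd_assoc, h₂]) ≫ act =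
      pullback.lift x (C.compose f g h₂)
        (by rw [InternalCategory.compose, Category.assoc, C.comp_cod, pullback.lift_fst_assoc, h₁]) ≫ act

namespace InternalPresheaf

variable {E : Type u} [Category.{v} E] [HasPullbacks E] {C : InternalCategory E}

/-- A morphism of internal presheaves: a map over the object of objects which commutes with
restriction. -/
@[ext]
structure Hom (F G : InternalPresheaf C) where
  map : F.X ⟶ G.X
  map_proj : map ≫ G.proj = F.proj
  map_act : F.act ≫ map =
    pullback.lift (pullback.fst F.proj C.cod ≫ map) (pullback.snd F.proj C.cod)
      (by rw [Category.assoc, map_proj, pullback.condition]) ≫ G.act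

instance : Category.{v} (InternalPresheaf C) where
  Hom F G := Hom F G
  id F := ⟨𝟙 F.X, by simp, by
    have : pullback.lift (pullback.fst F.proj C.cod ≫ 𝟙 F.X) (pullback.snd F.proj C.cod)
        (by simp [pullback.condition]) = 𝟙 _ := by apply pullback.hom_ext <;> simp [pullback.lift_fst, pullback.lift_snd,
        pullback.lift_fst_assoc, pullback.lift_snd_assoc]
    rw [this]; simp⟩
  comp {F G H} a b := ⟨a.map ≫ b.map, by rw [Category.assoc, b.map_proj, a.map_proj], by
    rw [← Category.assoc, a.map_act, Category.assoc, b.map_act, ← Category.assoc]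
    congr 1
    apply pullback.hom_ext <;> simp [pullback.lift_fst, pullback.lift_snd,
        pullback.lift_fst_assoc, pullback.lift_snd_assoc]⟩
  id_comp _ := Hom.ext (Category.id_comp _)
  comp_id _ := Hom.ext (Category.comp_id _)
  assoc _ _ _ := Hom.ext (Category.assoc _ _ _)

@[simp] lemma id_map (F : InternalPresheaf C) : Hom.map (𝟙 F) = 𝟙 F.X := rfl

@[simp] lemma comp_map {F G H : InternalPresheaf C} (a : F ⟶ G) (b : G ⟶ H) :
    Hom.map (a ≫ b) = Hom.map a ≫ Hom.map b := rfl

@[ext] lemma hom_ext {F G : InternalPresheaf C} {a b : F ⟶ G} (h : Hom.map a = Hom.map b) :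
    a = b := Hom.ext h

variable (C) in
/-- The forgetful functor `π^*` from internal presheaves to the slice over the object of
objects. -/
def forgetOver : InternalPresheaf C ⥤ Over C.Ob where
  obj F := Over.mk F.proj
  map a := Over.homMk (Hom.map a) (Hom.map_proj a)

/-- The class of *pointwise small* maps of internal presheaves: those `a` for which `π^* a` is
small in `E / C₀`, i.e. has a small underlying map in `E`. -/
def pointwiseSmall (S : MorphismProperty E) (C : InternalCategory E) :
    MorphismProperty (InternalPresheaf C) :=
  fun _ _ a => S ((forgetOver C).map a).left

/-! #### Pullbacks of internal presheaves -/

/-- Restriction of a generalised element along a generalised arrow. -/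
def restr (F : InternalPresheaf C) {T : E} (x : T ⟶ F.X) (f : T ⟶ C.Arr)
    (h : x ≫ F.proj = f ≫ C.cod) : T ⟶ F.X :=
  pullback.lift x f h ≫ F.act

lemma restr_proj (F : InternalPresheaf C) {T : E} (x : T ⟶ F.X) (f : T ⟶ C.Arr)
    (h : x ≫ F.proj = f ≫ C.cod) : F.restr x f h ≫ F.proj = f ≫ C.dom := by
  rw [restr, Category.assoc, F.act_proj, pullback.lift_snd_assoc]

lemma comp_restr (F : InternalPresheaf C) {T T' : E} (t : T' ⟶ T) (x : T ⟶ F.X) (f : T ⟶ C.Arr)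
    (h : x ≫ F.proj = f ≫ C.cod) :
    t ≫ F.restr x f h = F.restr (t ≫ x) (t ≫ f) (by simp [h]) := by
  simp only [restr, ← Category.assoc]
  congr 1
  apply pullback.hom_ext <;> simp [pullback.lift_fst, pullback.lift_snd,
        pullback.lift_fst_assoc, pullback.lift_snd_assoc]

lemma restr_map {F G : InternalPresheaf C} (a : F ⟶ G) {T : E} (x : T ⟶ F.X) (f : T ⟶ C.Arr)
    (h : x ≫ F.proj = f ≫ C.cod) :
    F.restr x f h ≫ a.map =
      G.restr (x ≫ a.map) f (by rw [Category.assoc, a.map_proj, h]) := by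
  simp only [restr, Category.assoc, a.map_act]
  simp only [← Category.assoc]
  congr 1
  apply pullback.hom_ext <;> simp [pullback.lift_fst, pullback.lift_snd,
        pullback.lift_fst_assoc, pullback.lift_snd_assoc]

lemma restr_id (F : InternalPresheaf C) {T : E} (x : T ⟶ F.X) (f : T ⟶ C.Arr)
    (hf : f = x ≫ F.proj ≫ C.ident) (h : x ≫ F.proj = f ≫ C.cod) : F.restr x f h = x := by
  subst hf
  conv_rhs => rw [← Category.comp_id x, ← F.act_id, ← Category.assoc]
  rw [restr]
  congr 1
  apply pullback.hom_ext <;> simp [pullback.lift_fst, pullback.lift_snd,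
        pullback.lift_fst_assoc, pullback.lift_snd_assoc]

lemma restr_restr (F : InternalPresheaf C) {T : E} (x : T ⟶ F.X) (f g : T ⟶ C.Arr)
    (h₁ : x ≫ F.proj = f ≫ C.cod) (h₂ : f ≫ C.dom = g ≫ C.cod) :
    F.restr (F.restr x f h₁) g (by rw [restr_proj, h₂]) =
      F.restr x (C.compose f g h₂)
        (by rw [InternalCategory.compose, Category.assoc, C.comp_cod, pullback.lift_fst_assoc, h₁]) :=
  F.act_comp x f g h₁ h₂

lemma restr_congr (F : InternalPresheaf C) {T : E} {x x' : T ⟶ F.X} {f f' : T ⟶ C.Arr}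
    (hx : x = x') (hf : f = f') (h : x ≫ F.proj = f ≫ C.cod) :
    F.restr x f h = F.restr x' f' (by rw [← hx, ← hf, h]) := by
  subst hx hf; rfl

section Pullback

variable {F G H : InternalPresheaf C} (a : F ⟶ H) (b : G ⟶ H)

lemma pb_left {T : E} (w : T ⟶ pullback a.map b.map) (f : T ⟶ C.Arr)
    (h : w ≫ pullback.fst a.map b.map ≫ F.proj = f ≫ C.cod) :
    (w ≫ pullback.fst a.map b.map) ≫ F.proj = f ≫ C.cod := by
  rw [Category.assoc, h]

lemma pb_right {T : E} (w : T ⟶ pullback a.map b.map) (f : T ⟶ C.Arr)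
    (h : w ≫ pullback.fst a.map b.map ≫ F.proj = f ≫ C.cod) :
    (w ≫ pullback.snd a.map b.map) ≫ G.proj = f ≫ C.cod := by
  rw [← h, ← a.map_proj, pullback.condition_assoc, b.map_proj, Category.assoc]

/-- Restriction in the pullback, on generalised elements. -/
def pbRestr {T : E} (w : T ⟶ pullback a.map b.map) (f : T ⟶ C.Arr)
    (h : w ≫ pullback.fst a.map b.map ≫ F.proj = f ≫ C.cod) : T ⟶ pullback a.map b.map :=
  pullback.lift
    (F.restr (w ≫ pullback.fst a.map b.map) f (pb_left a b w f h))
    (G.restr (w ≫ pullback.snd a.map b.map) f (pb_right a b w f h))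
    (by
      rw [restr_map, restr_map]
      exact restr_congr _ (by rw [Category.assoc, Category.assoc, pullback.condition]) rfl _)

lemma comp_pbRestr {T T' : E} (t : T' ⟶ T) (w : T ⟶ pullback a.map b.map) (f : T ⟶ C.Arr)
    (h : w ≫ pullback.fst a.map b.map ≫ F.proj = f ≫ C.cod) :
    t ≫ pbRestr a b w f h = pbRestr a b (t ≫ w) (t ≫ f) (by simp [h]) := by
  apply pullback.hom_ext
  · simp only [pbRestr, Category.assoc, pullback.lift_fst, comp_restr]
  · simp only [pbRestr, Category.assoc, pullback.lift_snd, comp_restr]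

lemma pbRestr_congr {T : E} {w w' : T ⟶ pullback a.map b.map} {f f' : T ⟶ C.Arr}
    (hw : w = w') (hf : f = f') (h : w ≫ pullback.fst a.map b.map ≫ F.proj = f ≫ C.cod) :
    pbRestr a b w f h = pbRestr a b w' f' (by rw [← hw, ← hf, h]) := by
  subst hw hf; rfl

lemma pbRestr_fst {T : E} (w : T ⟶ pullback a.map b.map) (f : T ⟶ C.Arr)
    (h : w ≫ pullback.fst a.map b.map ≫ F.proj = f ≫ C.cod) :
    pbRestr a b w f h ≫ pullback.fst a.map b.map =
      F.restr (w ≫ pullback.fst a.map b.map) f (pb_left a b w f h) :=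
  pullback.lift_fst _ _ _

lemma pbRestr_snd {T : E} (w : T ⟶ pullback a.map b.map) (f : T ⟶ C.Arr)
    (h : w ≫ pullback.fst a.map b.map ≫ F.proj = f ≫ C.cod) :
    pbRestr a b w f h ≫ pullback.snd a.map b.map =
      G.restr (w ≫ pullback.snd a.map b.map) f (pb_right a b w f h) :=
  pullback.lift_snd _ _ _

lemma pbRestr_proj {T : E} (w : T ⟶ pullback a.map b.map) (f : T ⟶ C.Arr)
    (h : w ≫ pullback.fst a.map b.map ≫ F.proj = f ≫ C.cod) :
    pbRestr a b w f h ≫ pullback.fst a.map b.map ≫ F.proj = f ≫ C.dom := by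
  rw [← Category.assoc, pbRestr_fst, restr_proj]

/-- The restriction map of the pullback of internal presheaves. -/
def pbAct : pullback (pullback.fst a.map b.map ≫ F.proj) C.cod ⟶ pullback a.map b.map :=
  pbRestr a b (pullback.fst _ C.cod) (pullback.snd _ C.cod) pullback.condition

lemma lift_pbAct {T : E} (w : T ⟶ pullback a.map b.map) (f : T ⟶ C.Arr)
    (h : w ≫ pullback.fst a.map b.map ≫ F.proj = f ≫ C.cod) :
    pullback.lift w f h ≫ pbAct a b = pbRestr a b w f h := by
  rw [pbAct, comp_pbRestr]
  exact pbRestr_congr a b (pullback.lift_fst _ _ _) (pullback.lift_snd _ _ _) _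

/-- The pullback of internal presheaves, computed on underlying objects. -/
def pb : InternalPresheaf C where
  X := pullback a.map b.map
  proj := pullback.fst a.map b.map ≫ F.proj
  act := pbAct a b
  act_proj := pbRestr_proj a b _ _ _
  act_id := by
    rw [lift_pbAct]
    apply pullback.hom_ext
    · rw [pbRestr_fst, restr_id _ _ _ (by simp)]
    · rw [pbRestr_snd, restr_id]
      simp only [Category.id_comp, Category.assoc]
      rw [← a.map_proj, Category.assoc, pullback.condition_assoc, ← b.map_proj, Category.assoc]
  act_comp := by
    intro T x f g h₁ h₂
    have e : pullback.lift x f h₁ ≫ pbAct a b = pbRestr a b x f h₁ := lift_pbAct a b x f h₁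
    have h₃ : pbRestr a b x f h₁ ≫ pullback.fst a.map b.map ≫ F.proj = g ≫ C.cod := by
      rw [pbRestr_proj, h₂]
    refine (lift_pbAct a b _ _ _).trans ((pbRestr_congr a b e rfl _).trans
      (Eq.trans ?_ (lift_pbAct a b _ _ _).symm))
    apply pullback.hom_ext
    · refine (pbRestr_fst a b _ _ h₃).trans (Eq.trans ?_ (pbRestr_fst a b _ _ _).symm)
      exact (F.restr_congr (pbRestr_fst a b x f h₁) rfl _).trans (F.restr_restr _ _ _ _ h₂)
    · refine (pbRestr_snd a b _ _ h₃).trans (Eq.trans ?_ (pbRestr_snd a b _ _ _).symm)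
      exact (G.restr_congr (pbRestr_snd a b x f h₁) rfl _).trans (G.restr_restr _ _ _ _ h₂)

/-- The first projection of the pullback of internal presheaves. -/
def pbFst : pb a b ⟶ F where
  map := pullback.fst a.map b.map
  map_proj := rfl
  map_act := pbRestr_fst a b _ _ pullback.condition

/-- The second projection of the pullback of internal presheaves. -/
def pbSnd : pb a b ⟶ G where
  map := pullback.snd a.map b.map
  map_proj := by
    change _ = pullback.fst a.map b.map ≫ F.proj
    rw [← a.map_proj, pullback.condition_assoc, b.map_proj]
    rfl
  map_act := pbRestr_snd a b _ _ pullback.condition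

/-- The map into the pullback of internal presheaves induced by a commuting square. -/
def pbLift {K : InternalPresheaf C} (s : K ⟶ F) (t : K ⟶ G) (h : s.map ≫ a.map = t.map ≫ b.map) :
    K ⟶ pb a b where
  map := pullback.lift s.map t.map h
  map_proj := by
    change pullback.lift s.map t.map h ≫ pullback.fst a.map b.map ≫ F.proj = _
    rw [pullback.lift_fst_assoc, s.map_proj]
  map_act := by
    have h₁ : (pullback.fst K.proj C.cod ≫ pullback.lift s.map t.map h) ≫
        pullback.fst a.map b.map ≫ F.proj = pullback.snd K.proj C.cod ≫ C.cod := by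
      rw [Category.assoc, pullback.lift_fst_assoc, s.map_proj, pullback.condition]
    refine Eq.trans ?_ (lift_pbAct a b _ _ h₁).symm
    change K.act ≫ pullback.lift s.map t.map h = _
    apply pullback.hom_ext
    · rw [pbRestr_fst, Category.assoc, pullback.lift_fst, s.map_act]
      exact F.restr_congr (by rw [Category.assoc, pullback.lift_fst]) rfl _
    · rw [pbRestr_snd, Category.assoc, pullback.lift_snd, t.map_act]
      exact G.restr_congr (by rw [Category.assoc, pullback.lift_snd]) rfl _

lemma pb_isPullback : IsPullback (pbFst a b) (pbSnd a b) a b where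
  w := hom_ext pullback.condition
  isLimit' := ⟨PullbackCone.IsLimit.mk _
    (fun s => pbLift a b s.fst s.snd (congrArg Hom.map s.condition))
    (fun _ => hom_ext (pullback.lift_fst _ _ _))
    (fun _ => hom_ext (pullback.lift_snd _ _ _))
    (fun s _ h₁ h₂ => hom_ext (pullback.hom_ext
      ((congrArg Hom.map h₁).trans
        (pullback.lift_fst _ _ (congrArg Hom.map s.condition)).symm)
      ((congrArg Hom.map h₂).trans
        (pullback.lift_snd _ _ (congrArg Hom.map s.condition)).symm)))⟩

end Pullback

instance : HasPullbacks (InternalPresheaf C) :=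
  have : ∀ {F G H : InternalPresheaf C} {a : F ⟶ H} {b : G ⟶ H}, HasLimit (cospan a b) :=
    fun {_ _ _ a b} => (pb_isPullback a b).hasPullback
  hasPullbacks_of_hasLimit_cospan _

end InternalPresheaf

end SmallMaps

end

/-!
Write `x · f` for restriction, and let `φ : B ⟶ A`, `j : A ⟶ X` be pointwise small maps of
presheaves. A multi-valued section of `φ` over a presheaf `Z ⟶ X` assigns to each element of `Z`
over `x` a multi-valued section, in `E`, of the small map `B_x ⟶ A_x`, where `A_x` consists of the
pairs `(f, a)` with `a` in `A` over `x · f` (`sharp`, `exists_isMvsSpan_sharp`), and these sections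
are compatible with restriction. Conversely, a multi-valued section of `B_x ⟶ A_x` in `E` generates
one that is closed under restriction: its elements are the `b · k` with `(f, b)` in the given
section, and it is contained in any closed one that contains the given section
(`exists_isMvsSpan_of_sharp`).

Fullness of `E`, applied to the family of all the maps `B_x ⟶ A_x`, gives a cover `X₁ ⟶ X` and a
small family `M ⟶ X₁` of multi-valued sections refining all others. The difficulty is to turn this
into presheaves `Y ⟶ X' ⟶ X` with `Y` small over `X'`. A section chosen over `x` can be restricted
along an arrow `f`, but over `x · f` there have to be further members of `Y`, chosen over `x · f`
itself; since `X₁ ⟶ X` is only a cover, these come from lifts of `x · f` to `X₁`, of which there is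
no canonical one. Collection, applied to the cover of the small object of all pairs `(x, f)` over
`x` by such lifts, provides a cover `B' ⟶ X` and a small family `Z' ⟶ B'` containing, for each
`x` in `B'` and each arrow `f`, at least one lift `t` of `x · f` to `X₁`. One takes for `X'` the
presheaf freely generated by `B'`, and for `Y` the presheaf freely generated by the pairs of an
element `t` of `Z'` and an element of `M` over it. The map `Y ⟶ X'` is small by left cancellation
(`IsClassOfSmallMaps.of_comp`), because `Y ⟶ B'` is a composite of small maps. For a multi-valued
section `Q` over `Z ⟶ X'`, an element of `Z` lies over some `(x, f)` in `X'`; after passing to a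
cover, a lift `t` of `x · f` and a member of `M` over `t` contained in `Q` are found, and the
element `((t, m), id)` of `Y` is the one required. The cover of `Z` is again a free presheaf, so
that it suffices to check everything on generators.

Two reformulations keep the argument elementary: fullness is stated with jointly monic spans instead
of subobjects (`Fullness.spanFullness`, `SpanFullness.fullness`), and covers and multi-valued
sections of presheaves are recognised on total objects (`isCover_iff_isCover_map`,
`isMvsSpan_pointwiseSmall_iff`).
-/

noncomputable section

namespace SmallMaps

/-! ### Covers in a regular category -/

section Cover

variable {E : Type u} [Category.{v} E]

lemma IsCover.of_comp {X Y Z : E} {f : X ⟶ Y} {g : Y ⟶ Z} (h : IsCover (f ≫ g)) : IsCover g :=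
  fun _ m _ k hk => h m (f ≫ k) (by rw [Category.assoc, hk])

lemma isCover_of_strongEpi {X Y : E} (f : X ⟶ Y) [StrongEpi f] : IsCover f := by
  intro M m _ g hg
  have : StrongEpi (g ≫ m) := by rw [hg]; infer_instance
  have : StrongEpi m := strongEpi_of_strongEpi g m
  exact isIso_of_mono_of_strongEpi m

variable [Regular E]

lemma IsCover.isRegularEpi {X Y : E} {f : X ⟶ Y} (h : IsCover f) : IsRegularEpi f := by
  have := h (Regular.strongEpiMonoFactorisation f).m (Regular.strongEpiMonoFactorisation f).e
    (by simp)
  exact ⟨⟨RegularEpi.ofArrowIso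
    (Arrow.isoMk (f := .mk (Regular.strongEpiMonoFactorisation f).e) (g := .mk f) (Iso.refl _)
      (asIso (Regular.strongEpiMonoFactorisation f).m)) (IsRegularEpi.getStruct _)⟩⟩

lemma IsCover.strongEpi {X Y : E} {f : X ⟶ Y} (h : IsCover f) : StrongEpi f :=
  have := h.isRegularEpi
  inferInstance

lemma IsCover.comp {X Y Z : E} {f : X ⟶ Y} {g : Y ⟶ Z} (hf : IsCover f) (hg : IsCover g) :
    IsCover (f ≫ g) :=
  have := hf.strongEpi
  have := hg.strongEpi
  have := strongEpi_comp f g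
  isCover_of_strongEpi _

lemma IsCover.of_isPullback {D B C A : E} {d : D ⟶ B} {g : D ⟶ C} {f : B ⟶ A} {p : C ⟶ A}
    (h : IsPullback d g f p) (hf : IsCover f) : IsCover g :=
  have : IsRegularEpi g :=
    Regular.regularEpiIsStableUnderBaseChange.of_isPullback h hf.isRegularEpi
  isCover_of_strongEpi g

/-- A pair of maps that factors through a jointly monic pair after precomposition with a cover
already factors through it. -/
lemma IsCover.exists_lift_pair {T' T Q Z B : E} {τ : T' ⟶ T} (hτ : IsCover τ) {s : Q ⟶ Z}
    {c : Q ⟶ B} (hsc : ∀ ⦃W : E⦄ (a b : W ⟶ Q), a ≫ s = b ≫ s → a ≫ c = b ≫ c → a = b)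
    {x : T ⟶ Z} {y : T ⟶ B} {t : T' ⟶ Q} (hs : t ≫ s = τ ≫ x) (hc : t ≫ c = τ ≫ y) :
    ∃ r : T ⟶ Q, r ≫ s = x ∧ r ≫ c = y := by
  have := hτ.strongEpi
  have : Mono (prod.lift s c) := ⟨fun a b h => hsc a b
    (by simpa [prod.lift_fst] using congrArg (· ≫ prod.fst) h)
    (by simpa [prod.lift_snd] using congrArg (· ≫ prod.snd) h)⟩
  have sq : CommSq t τ (prod.lift s c) (prod.lift x y) := ⟨by
    ext <;> simp [hs, hc, prod.lift_fst, prod.lift_snd]⟩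
  exact ⟨sq.lift, by simpa [prod.lift_fst] using congrArg (· ≫ prod.fst) sq.fac_right,
    by simpa [prod.lift_snd] using congrArg (· ≫ prod.snd) sq.fac_right⟩

end Cover

/-! ### Small maps -/

namespace IsClassOfSmallMaps

variable {E : Type u} [Category.{v} E] [PositiveHeyting E] {S : MorphismProperty E}

lemma respectsIso (hS : IsClassOfSmallMaps S) : S.RespectsIso :=
  MorphismProperty.RespectsIso.of_respects_arrow_iso _ fun _ _ e hf =>
    hS.pullback_stability (IsPullback.of_horiz_isIso ⟨e.inv.w⟩) hf

/-- Left cancellation: a map into the domain of any map is small as soon as the composite is.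
It is the graph, a pullback of a diagonal, followed by a pullback of the composite. -/
lemma of_comp (hS : IsClassOfSmallMaps S) {X Y Z : E} {f : X ⟶ Y} {g : Y ⟶ Z}
    (h : S (f ≫ g)) : S f := by
  have h₂ : S (pullback.snd (f ≫ g) g) :=
    hS.pullback_stability (IsPullback.of_hasPullback (f ≫ g) g) h
  have h₁ : S (pullback.lift (𝟙 X) f (by simp) : X ⟶ pullback (f ≫ g) g) := by
    refine hS.pullback_stability (d := f) (f := diag Y)
      (p := prod.lift (pullback.fst (f ≫ g) g ≫ f) (pullback.snd (f ≫ g) g)) ?_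
      (hS.diagonals Y)
    refine IsPullback.mk'
      (by ext <;> simp [prod.lift_fst, prod.lift_snd, pullback.lift_snd,
        pullback.lift_fst_assoc])
      (fun T a b _ h => by
        simpa [pullback.lift_fst] using congrArg (· ≫ pullback.fst _ _) h)
      fun T a b h => ⟨b ≫ pullback.fst _ _, ?_, ?_⟩
    · simpa [prod.lift_fst] using (congrArg (· ≫ prod.fst) h).symm
    · have h₁ := congrArg (· ≫ prod.fst) h
      have h₂ := congrArg (· ≫ prod.snd) h
      simp only [Category.assoc, prod.lift_fst, prod.lift_snd, diag, Category.comp_id] at h₁ h₂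
      apply pullback.hom_ext
      · simp [pullback.lift_fst]
      · rw [Category.assoc, pullback.lift_snd, Category.assoc, ← h₁, h₂]
  simpa [pullback.lift_snd] using hS.composition _ _ h₁ h₂

lemma of_fst_pullback (hS : IsClassOfSmallMaps S) {X Y Z : E} (f : X ⟶ Z) {g : Y ⟶ Z} (hg : S g) :
    S (pullback.fst f g) :=
  hS.pullback_stability (IsPullback.of_hasPullback f g).flip hg

lemma of_snd_pullback (hS : IsClassOfSmallMaps S) {X Y Z : E} {f : X ⟶ Z} (g : Y ⟶ Z) (hf : S f) :
    S (pullback.snd f g) :=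
  hS.pullback_stability (IsPullback.of_hasPullback f g) hf

end IsClassOfSmallMaps

/-! ### Multi-valued sections as spans -/

section Span

variable {D : Type u} [Category.{v} D] [HasPullbacks D]

/-- A multi-valued section of `φ : B ⟶ A` over `f : Y ⟶ X`, presented as a jointly monic span
`Y ⟵ P ⟶ B` over `X` instead of as a subobject of a chosen pullback. -/
structure IsMvsSpan (S : MorphismProperty D) {B A X Y P : D} (φ : B ⟶ A) (j : A ⟶ X) (f : Y ⟶ X)
    (p : P ⟶ Y) (b : P ⟶ B) : Prop where
  w : p ≫ f = (b ≫ φ) ≫ j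
  isCover : IsCover (pullback.lift p (b ≫ φ) w)
  small : S (pullback.lift p (b ≫ φ) w)
  jointly_mono : ∀ ⦃T : D⦄ (s t : T ⟶ P), s ≫ p = t ≫ p → s ≫ b = t ≫ b → s = t

/-- The fullness axiom in terms of spans: the inequality `k^* P ≤ l^* Q` is tested on generalised
elements. -/
def SpanFullness (S : MorphismProperty D) : Prop :=
  ∀ ⦃B A X : D⦄ (φ : B ⟶ A) (j : A ⟶ X), S φ → S j →
    ∃ (X' Y P : D) (q : X' ⟶ X) (y : Y ⟶ X') (p : P ⟶ Y) (b : P ⟶ B),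
      IsCover q ∧ S y ∧ IsMvsSpan S φ j (y ≫ q) p b ∧
      ∀ ⦃Z Q : D⦄ (z : Z ⟶ X') (s : Q ⟶ Z) (c : Q ⟶ B), IsMvsSpan S φ j (z ≫ q) s c →
        ∃ (U : D) (k : U ⟶ Y) (l : U ⟶ Z), k ≫ y = l ≫ z ∧ IsCover l ∧
          ∀ ⦃T : D⦄ (m : T ⟶ U) (r : T ⟶ P), r ≫ p = m ≫ k →
            ∃ t : T ⟶ Q, t ≫ s = m ≫ l ∧ t ≫ c = r ≫ b

variable {S : MorphismProperty D} {B A X Y : D} {φ : B ⟶ A} {j : A ⟶ X} {f : Y ⟶ X}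

lemma IsMvs.isMvsSpan {P : Subobject (pullback f (φ ≫ j))} (h : IsMvs S φ j f P) :
    IsMvsSpan S φ j f (P.arrow ≫ pullback.fst _ _) (P.arrow ≫ pullback.snd _ _) := by
  have w : (P.arrow ≫ pullback.fst _ _) ≫ f = ((P.arrow ≫ pullback.snd _ _) ≫ φ) ≫ j := by
    simp only [Category.assoc, pullback.condition]
  have e : pullback.lift (P.arrow ≫ pullback.fst _ _) ((P.arrow ≫ pullback.snd _ _) ≫ φ) w =
      P.arrow ≫ reindexMap φ j f := by
    apply pullback.hom_ext <;>
      simp [reindexMap, pullback.lift_fst, pullback.lift_snd]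
  refine ⟨w, by rw [e]; exact h.1, by rw [e]; exact h.2, fun T s t h₁ h₂ => ?_⟩
  rw [← cancel_mono P.arrow]
  apply pullback.hom_ext
  · simpa using h₁
  · simpa using h₂

lemma IsMvsSpan.w' {P : D} {p : P ⟶ Y} {b : P ⟶ B} (h : IsMvsSpan S φ j f p b) :
    p ≫ f = b ≫ φ ≫ j := by
  rw [h.w, Category.assoc]

lemma IsMvsSpan.mono {P : D} {p : P ⟶ Y} {b : P ⟶ B} (h : IsMvsSpan S φ j f p b) :
    Mono (pullback.lift p b h.w') :=
  ⟨fun s t e => h.jointly_mono s t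
    (by simpa [pullback.lift_fst] using congrArg (· ≫ pullback.fst _ _) e)
    (by simpa [pullback.lift_snd] using congrArg (· ≫ pullback.snd _ _) e)⟩

lemma IsMvsSpan.isMvs [S.RespectsIso] {P : D} {p : P ⟶ Y} {b : P ⟶ B}
    (h : IsMvsSpan S φ j f p b) [Mono (pullback.lift p b h.w')] :
    IsMvs S φ j f (Subobject.mk (pullback.lift p b h.w')) := by
  have e : pullback.lift p b h.w' ≫ reindexMap φ j f = pullback.lift p (b ≫ φ) h.w := by
    apply pullback.hom_ext <;>
      simp [reindexMap, pullback.lift_fst, pullback.lift_snd, pullback.lift_snd_assoc]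
  have e₁ : (Subobject.mk (pullback.lift p b h.w')).arrow ≫ reindexMap φ j f =
      (Subobject.underlyingIso (pullback.lift p b h.w')).hom ≫ pullback.lift p (b ≫ φ) h.w := by
    rw [← e, ← Category.assoc, Subobject.underlyingIso_hom_comp_eq_mk]
  constructor
  · rw [e₁]
    intro M m _ g hg
    exact h.isCover m ((Subobject.underlyingIso (pullback.lift p b h.w')).inv ≫ g)
      (by rw [Category.assoc, hg, Iso.inv_hom_id_assoc])
  · rw [e₁, MorphismProperty.cancel_left_of_respectsIso S]
    exact h.small

lemma mk_lift_factors_iff {P : D} {p : P ⟶ Y} {b : P ⟶ B} (w : p ≫ f = b ≫ φ ≫ j)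
    [Mono (pullback.lift p b w)] {T : D} (g : T ⟶ pullback f (φ ≫ j)) :
    (Subobject.mk (pullback.lift p b w)).Factors g ↔
      ∃ t : T ⟶ P, t ≫ p = g ≫ pullback.fst _ _ ∧ t ≫ b = g ≫ pullback.snd _ _ := by
  refine (Subobject.mk_factors_iff _ _).trans
    ⟨fun ⟨t, ht⟩ => ⟨t, ?_, ?_⟩, fun ⟨t, h₁, h₂⟩ => ⟨t, ?_⟩⟩
  · rw [← ht, Category.assoc]
    exact congrArg (t ≫ ·) (pullback.lift_fst _ _ _).symm
  · rw [← ht, Category.assoc]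
    exact congrArg (t ≫ ·) (pullback.lift_snd _ _ _).symm
  · change t ≫ pullback.lift p b w = g
    apply pullback.hom_ext
    · simpa [pullback.lift_fst] using h₁
    · simpa [pullback.lift_snd] using h₂

lemma factors_pullback_iff {W V : D} (g : W ⟶ V) (P : Subobject V) {T : D} (t : T ⟶ W) :
    ((Subobject.pullback g).obj P).Factors t ↔ P.Factors (t ≫ g) := by
  constructor
  · intro h
    have e : t ≫ g = (((Subobject.pullback g).obj P).factorThru t h ≫ Subobject.pullbackπ g P) ≫
        P.arrow := by
      rw [Category.assoc, (Subobject.isPullback g P).w, Subobject.factorThru_arrow_assoc]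
    rw [e]
    exact Subobject.factors_comp_arrow _
  · intro h
    rw [← (Subobject.isPullback g P).lift_snd (P.factorThru _ h) t (by simp)]
    exact Subobject.factors_comp_arrow _

lemma comp_baseChangeMap_fst {B X Y U T : D} (b : B ⟶ X) (f : Y ⟶ X) (k : U ⟶ Y) {g : U ⟶ X}
    (h : k ≫ f = g) (t : T ⟶ pullback g b) :
    (t ≫ baseChangeMap b f k g h) ≫ pullback.fst f b = (t ≫ pullback.fst g b) ≫ k := by
  rw [Category.assoc, baseChangeMap, pullback.lift_fst, Category.assoc]

lemma comp_baseChangeMap_snd {B X Y U T : D} (b : B ⟶ X) (f : Y ⟶ X) (k : U ⟶ Y) {g : U ⟶ X}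
    (h : k ≫ f = g) (t : T ⟶ pullback g b) :
    (t ≫ baseChangeMap b f k g h) ≫ pullback.snd f b = t ≫ pullback.snd g b := by
  rw [Category.assoc, baseChangeMap, pullback.lift_snd]

lemma Fullness.spanFullness [S.RespectsIso] (h : Fullness S) : SpanFullness S := by
  intro B A X φ j hφ hj
  obtain ⟨X', Y, q, y, P, hq, hy, hP, H⟩ := h φ j hφ hj
  refine ⟨X', Y, _, q, y, _, _, hq, hy, hP.isMvsSpan, fun Z Q z s c hQ => ?_⟩
  have := hQ.mono
  obtain ⟨U, k, l, e, hl, hle⟩ := H z _ hQ.isMvs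
  refine ⟨U, k, l, e, hl, fun T m r hr => ?_⟩
  have hw : m ≫ l ≫ z ≫ q = (r ≫ P.arrow ≫ pullback.snd _ _) ≫ φ ≫ j := by
    simp only [Category.assoc, ← pullback.condition]
    rw [← Category.assoc l, ← e, ← Category.assoc m, ← Category.assoc m, ← hr]
    simp
  have h₁ : ((Subobject.pullback (baseChangeMap (φ ≫ j) (y ≫ q) k (l ≫ z ≫ q)
      (by rw [← Category.assoc, e, Category.assoc]))).obj P).Factors (pullback.lift m _ hw) := by
    have e₁ : pullback.lift m _ hw ≫ baseChangeMap (φ ≫ j) (y ≫ q) k (l ≫ z ≫ q)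
        (by rw [← Category.assoc, e, Category.assoc]) = r ≫ P.arrow := by
      apply pullback.hom_ext
      · simpa [baseChangeMap, pullback.lift_fst, pullback.lift_fst_assoc] using hr.symm
      · simp [baseChangeMap, pullback.lift_snd]
    rw [factors_pullback_iff, e₁]
    exact Subobject.factors_comp_arrow _
  obtain ⟨t, ht₁, ht₂⟩ := (mk_lift_factors_iff hQ.w' _).1
    ((factors_pullback_iff _ _ _).1 (Subobject.factors_of_le _ hle h₁))
  refine ⟨t, ?_, ?_⟩
  · simpa [baseChangeMap, pullback.lift_fst, pullback.lift_fst_assoc] using ht₁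
  · simpa [baseChangeMap, pullback.lift_snd] using ht₂

lemma SpanFullness.fullness [S.RespectsIso] (h : SpanFullness S) : Fullness S := by
  intro B A X φ j hφ hj
  obtain ⟨X', Y, P, q, y, p, b, hq, hy, hP, H⟩ := h φ j hφ hj
  have := hP.mono
  refine ⟨X', Y, q, y, _, hq, hy, hP.isMvs, fun Z z Q hQ => ?_⟩
  obtain ⟨U, k, l, e, hl, hle⟩ := H z _ _ hQ.isMvsSpan
  refine ⟨U, k, l, e, hl, Subobject.le_of_factors ((factors_pullback_iff _ _ _).2 ?_)⟩
  obtain ⟨r, hr₁, hr₂⟩ := (mk_lift_factors_iff hP.w' _).1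
    ((factors_pullback_iff _ _ _).1 (Subobject.factors_self
      ((Subobject.pullback (baseChangeMap (φ ≫ j) (y ≫ q) k (l ≫ z ≫ q)
        (by rw [← Category.assoc, e, Category.assoc]))).obj
          (Subobject.mk (pullback.lift p b hP.w')))))
  obtain ⟨t, ht₁, ht₂⟩ := hle (Subobject.arrow _ ≫ pullback.fst _ _) r
    (by simpa [baseChangeMap, pullback.lift_fst] using hr₁)
  have e₁ : Subobject.arrow _ ≫ baseChangeMap (φ ≫ j) (z ≫ q) l (l ≫ z ≫ q) rfl =
      t ≫ Q.arrow := by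
    apply pullback.hom_ext
    · exact (comp_baseChangeMap_fst _ _ _ _ _).trans
        (ht₁.symm.trans (Category.assoc _ _ _).symm)
    · exact (comp_baseChangeMap_snd _ _ _ _ _).trans
        ((comp_baseChangeMap_snd _ _ _ _ _).symm.trans
          (hr₂.symm.trans (ht₂.symm.trans (Category.assoc _ _ _).symm)))
  rw [e₁]
  exact Subobject.factors_comp_arrow _

end Span

section BaseChange

variable {E : Type u} [Category.{v} E] [PositiveHeyting E] {S : MorphismProperty E}

lemma IsMvsSpan.baseChange (hS : IsClassOfSmallMaps S) {B A X Y Y' P : E}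
    {φ : B ⟶ A} {j : A ⟶ X} {f : Y ⟶ X} {p : P ⟶ Y} {b : P ⟶ B} (h : IsMvsSpan S φ j f p b)
    (g : Y' ⟶ Y) {f' : Y' ⟶ X} (hf : g ≫ f = f') :
    IsMvsSpan S φ j f' (pullback.snd p g) (pullback.fst p g ≫ b) := by
  have w : pullback.snd p g ≫ f' = ((pullback.fst p g ≫ b) ≫ φ) ≫ j := by
    rw [← hf, ← pullback.condition_assoc, h.w]; simp only [Category.assoc]
  have hpb : IsPullback (pullback.fst p g) (pullback.lift _ _ w)
      (pullback.lift p (b ≫ φ) h.w)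
      (pullback.lift (pullback.fst f' j ≫ g) (pullback.snd f' j)
        (by rw [Category.assoc, hf, pullback.condition])) := by
    refine IsPullback.mk' ?_ ?_ ?_
    · apply pullback.hom_ext
      · simp [pullback.lift_fst, pullback.lift_fst_assoc, pullback.condition]
      · simp [pullback.lift_snd]
    · intro T s t h₁ h₂
      apply pullback.hom_ext h₁
      simpa [pullback.lift_fst] using congrArg (· ≫ pullback.fst _ _) h₂
    · intro T s t hst
      have h₁ := congrArg (· ≫ pullback.fst _ _) hst
      have h₂ := congrArg (· ≫ pullback.snd _ _) hst
      simp only [Category.assoc, pullback.lift_fst, pullback.lift_snd] at h₁ h₂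
      refine ⟨pullback.lift s (t ≫ pullback.fst _ _) (by rw [h₁, Category.assoc]),
        pullback.lift_fst _ _ _, ?_⟩
      apply pullback.hom_ext
      · simp [pullback.lift_fst, pullback.lift_snd]
      · simp [pullback.lift_fst_assoc, pullback.lift_snd, h₂]
  refine ⟨w, IsCover.of_isPullback hpb h.isCover, hS.pullback_stability hpb h.small, ?_⟩
  intro T s t h₁ h₂
  refine pullback.hom_ext (h.jointly_mono _ _ ?_ (by simpa using h₂)) h₁
  rw [Category.assoc, Category.assoc, pullback.condition, ← Category.assoc, h₁, Category.assoc]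

end BaseChange

/-! ### Generalised arrows of an internal category -/

namespace InternalCategory

variable {E : Type u} [Category.{v} E] [HasPullbacks E] (C : InternalCategory E)

lemma comp_compose {T T' : E} (t : T' ⟶ T) (f g : T ⟶ C.Arr) (h : f ≫ C.dom = g ≫ C.cod) :
    t ≫ C.compose f g h = C.compose (t ≫ f) (t ≫ g) (by simp [h]) := by
  simp only [compose, ← Category.assoc]
  congr 1
  apply pullback.hom_ext <;> simp [pullback.lift_fst, pullback.lift_snd]

lemma compose_dom {T : E} (f g : T ⟶ C.Arr) (h : f ≫ C.dom = g ≫ C.cod) :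
    C.compose f g h ≫ C.dom = g ≫ C.dom := by
  rw [compose, Category.assoc, C.comp_dom, pullback.lift_snd_assoc]

lemma compose_cod {T : E} (f g : T ⟶ C.Arr) (h : f ≫ C.dom = g ≫ C.cod) :
    C.compose f g h ≫ C.cod = f ≫ C.cod := by
  rw [compose, Category.assoc, C.comp_cod, pullback.lift_fst_assoc]

lemma compose_congr {T : E} {f f' g g' : T ⟶ C.Arr} (hf : f = f') (hg : g = g')
    (h : f ≫ C.dom = g ≫ C.cod) :
    C.compose f g h = C.compose f' g' (by rw [← hf, ← hg, h]) := by
  subst hf hg; rfl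

lemma compose_ident {T : E} (f g : T ⟶ C.Arr) (hg : g = f ≫ C.dom ≫ C.ident)
    (h : f ≫ C.dom = g ≫ C.cod) : C.compose f g h = f := by
  subst hg; exact C.comp_id f

lemma ident_compose {T : E} (f g : T ⟶ C.Arr) (hf : f = g ≫ C.cod ≫ C.ident)
    (h : f ≫ C.dom = g ≫ C.cod) : C.compose f g h = g := by
  subst hf; exact C.id_comp g

lemma compose_assoc {T : E} (f g k : T ⟶ C.Arr) (h₁ : f ≫ C.dom = g ≫ C.cod)
    (h₂ : g ≫ C.dom = k ≫ C.cod) :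
    C.compose (C.compose f g h₁) k (by rw [compose_dom, h₂]) =
      C.compose f (C.compose g k h₂) (by rw [compose_cod, h₁]) :=
  C.assoc f g k h₁ h₂

end InternalCategory

namespace InternalPresheaf

section

variable {E : Type u} [Category.{v} E] [HasPullbacks E] {C : InternalCategory E}

/-! ### Free presheaves -/

variable (C) in
/-- The presheaf freely generated by an object `W` over the object of objects: its generalised
elements are pairs `(u, f)` of an element `u` of `W` and an arrow `f` into the object below `u`,
and arrows act by precomposition. -/
def free {W : E} (w : W ⟶ C.Ob) : InternalPresheaf C where
  X := pullback w C.cod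
  proj := pullback.snd w C.cod ≫ C.dom
  act := pullback.lift (pullback.fst _ C.cod ≫ pullback.fst w C.cod)
    (C.compose (pullback.fst _ C.cod ≫ pullback.snd w C.cod) (pullback.snd _ C.cod)
      (by rw [Category.assoc, pullback.condition]))
    (by rw [C.compose_cod, Category.assoc, Category.assoc, pullback.condition])
  act_proj := by rw [pullback.lift_snd_assoc, C.compose_dom]
  act_id := by
    apply pullback.hom_ext
    · rw [Category.assoc, pullback.lift_fst, pullback.lift_fst_assoc]
    · rw [Category.assoc, pullback.lift_snd, C.comp_compose, C.compose_ident,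
        pullback.lift_fst_assoc]
      rw [pullback.lift_snd, pullback.lift_fst_assoc]
      simp
  act_comp := by
    intro T x f g h₁ h₂
    apply pullback.hom_ext
    · simp [pullback.lift_fst, pullback.lift_fst_assoc]
    · simp only [Category.assoc, pullback.lift_snd, C.comp_compose]
      have e : (x ≫ pullback.snd w C.cod) ≫ C.dom = f ≫ C.cod := by rw [Category.assoc, h₁]
      refine Eq.trans (C.compose_congr (f' := C.compose (x ≫ pullback.snd w C.cod) f e)
        (g' := g) ?_ rfl _) ((C.compose_assoc _ _ _ e h₂).trans
          (C.compose_congr (pullback.lift_fst_assoc _ _ _ _).symm rfl _))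
      rw [pullback.lift_fst_assoc, Category.assoc, pullback.lift_snd, C.comp_compose]
      exact C.compose_congr (pullback.lift_fst_assoc _ _ _ _) (pullback.lift_snd _ _ _) _

variable {W : E} {w : W ⟶ C.Ob}

variable (C w) in
/-- The first component `u` of an element `(u, f)` of a free presheaf. -/
def freeGen : (free C w).X ⟶ W := pullback.fst w C.cod

variable (C w) in
/-- The second component `f` of an element `(u, f)` of a free presheaf. -/
def freeArr : (free C w).X ⟶ C.Arr := pullback.snd w C.cod

lemma free_condition : freeGen C w ≫ w = freeArr C w ≫ C.cod := pullback.condition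

lemma free_proj : (free C w).proj = freeArr C w ≫ C.dom := rfl

/-- The element `(u, f)` of a free presheaf. -/
def freeMk {T : E} (u : T ⟶ W) (f : T ⟶ C.Arr) (h : u ≫ w = f ≫ C.cod) : T ⟶ (free C w).X :=
  pullback.lift u f h

@[simp] lemma freeMk_gen {T : E} (u : T ⟶ W) (f : T ⟶ C.Arr) (h : u ≫ w = f ≫ C.cod) :
    freeMk u f h ≫ freeGen C w = u := pullback.lift_fst _ _ _

@[simp] lemma freeMk_arr {T : E} (u : T ⟶ W) (f : T ⟶ C.Arr) (h : u ≫ w = f ≫ C.cod) :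
    freeMk u f h ≫ freeArr C w = f := pullback.lift_snd _ _ _

lemma free_ext {T : E} {x y : T ⟶ (free C w).X} (h₁ : x ≫ freeGen C w = y ≫ freeGen C w)
    (h₂ : x ≫ freeArr C w = y ≫ freeArr C w) : x = y :=
  pullback.hom_ext h₁ h₂

variable (C w) in
/-- The inclusion of the generators, `u ↦ (u, id)`. -/
def freeUnit : W ⟶ (free C w).X :=
  freeMk (𝟙 W) (w ≫ C.ident)
    (by rw [Category.assoc, C.ident_cod, Category.id_comp, Category.comp_id])

@[simp] lemma freeUnit_gen : freeUnit C w ≫ freeGen C w = 𝟙 W := freeMk_gen _ _ _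

@[simp] lemma freeUnit_arr : freeUnit C w ≫ freeArr C w = w ≫ C.ident := freeMk_arr _ _ _

lemma freeUnit_proj : freeUnit C w ≫ (free C w).proj = w := by
  rw [free_proj, ← Category.assoc, freeUnit_arr, Category.assoc, C.ident_dom, Category.comp_id]

lemma free_act_gen : (free C w).act ≫ freeGen C w =
    pullback.fst (free C w).proj C.cod ≫ freeGen C w := pullback.lift_fst _ _ _

lemma free_act_arr : (free C w).act ≫ freeArr C w =
    C.compose (pullback.fst (free C w).proj C.cod ≫ freeArr C w) (pullback.snd _ C.cod)
      (by rw [Category.assoc, ← free_proj, pullback.condition]) := pullback.lift_snd _ _ _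

lemma free_restr_gen {T : E} (x : T ⟶ (free C w).X) (f : T ⟶ C.Arr)
    (h : x ≫ (free C w).proj = f ≫ C.cod) :
    (free C w).restr x f h ≫ freeGen C w = x ≫ freeGen C w := by
  rw [restr, Category.assoc, free_act_gen, pullback.lift_fst_assoc]

lemma free_restr_arr {T : E} (x : T ⟶ (free C w).X) (f : T ⟶ C.Arr)
    (h : x ≫ (free C w).proj = f ≫ C.cod) :
    (free C w).restr x f h ≫ freeArr C w =
      C.compose (x ≫ freeArr C w) f (by rw [Category.assoc, ← free_proj, h]) := by
  rw [restr, Category.assoc, free_act_arr, C.comp_compose]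
  exact C.compose_congr (pullback.lift_fst_assoc _ _ _ _) (pullback.lift_snd _ _ _) _

lemma free_generator_proj {T : E} (x : T ⟶ (free C w).X) :
    ((x ≫ freeGen C w) ≫ freeUnit C w) ≫ (free C w).proj = (x ≫ freeArr C w) ≫ C.cod := by
  rw [Category.assoc, freeUnit_proj, Category.assoc, free_condition, Category.assoc]

/-- Every element `(u, f)` of a free presheaf is the restriction of the generator `u` along `f`. -/
lemma free_restr_generator {T : E} (x : T ⟶ (free C w).X) :
    (free C w).restr ((x ≫ freeGen C w) ≫ freeUnit C w) (x ≫ freeArr C w)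
      (free_generator_proj x) = x := by
  apply free_ext
  · rw [free_restr_gen, Category.assoc, freeUnit_gen, Category.comp_id]
  · rw [free_restr_arr]
    apply C.ident_compose
    rw [Category.assoc, freeUnit_arr, Category.assoc, Category.assoc, ← Category.assoc _ w,
      free_condition, Category.assoc]

/-- The map out of a free presheaf determined by the images of the generators. -/
def freeLift {F : InternalPresheaf C} (s : W ⟶ F.X) (hs : s ≫ F.proj = w) : free C w ⟶ F where
  map := F.restr (freeGen C w ≫ s) (freeArr C w) (by rw [Category.assoc, hs, free_condition])
  map_proj := F.restr_proj _ _ _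
  map_act := by
    have h₁ : (pullback.fst (free C w).proj C.cod ≫ freeGen C w ≫ s) ≫ F.proj =
        (pullback.fst (free C w).proj C.cod ≫ freeArr C w) ≫ C.cod := by
      simp only [Category.assoc, hs, free_condition]
    have h₂ : (pullback.fst (free C w).proj C.cod ≫ freeArr C w) ≫ C.dom =
        pullback.snd (free C w).proj C.cod ≫ C.cod := by
      rw [Category.assoc, ← free_proj, pullback.condition]
    rw [comp_restr]
    refine Eq.trans ?_ ((F.restr_restr _ _ _ h₁ h₂).symm.trans
      (F.restr_congr (F.comp_restr _ _ _ _).symm rfl _))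
    exact F.restr_congr (by rw [← Category.assoc, free_act_gen, Category.assoc]) free_act_arr _

lemma comp_freeLift_map {F : InternalPresheaf C} (s : W ⟶ F.X) (hs : s ≫ F.proj = w) {T : E}
    (x : T ⟶ (free C w).X) :
    x ≫ (freeLift s hs).map = F.restr ((x ≫ freeGen C w) ≫ s) (x ≫ freeArr C w)
      (by simp only [Category.assoc, hs, free_condition]) :=
  (F.comp_restr _ _ _ _).trans (F.restr_congr (Category.assoc _ _ _).symm rfl _)

@[simp] lemma freeUnit_freeLift {F : InternalPresheaf C} (s : W ⟶ F.X) (hs : s ≫ F.proj = w) :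
    freeUnit C w ≫ (freeLift s hs).map = s := by
  have h : s ≫ F.proj = (w ≫ C.ident) ≫ C.cod := by
    rw [hs, Category.assoc, C.ident_cod, Category.comp_id]
  rw [comp_freeLift_map]
  refine (F.restr_congr (x' := s) (f' := w ≫ C.ident) ?_ freeUnit_arr _).trans
    (F.restr_id _ _ ?_ h)
  · rw [freeUnit_gen, Category.id_comp]
  · rw [← hs, Category.assoc]

lemma free_hom_ext {F : InternalPresheaf C} {a b : free C w ⟶ F}
    (h : freeUnit C w ≫ a.map = freeUnit C w ≫ b.map) : a = b := by
  apply hom_ext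
  rw [← Category.id_comp a.map, ← Category.id_comp b.map, ← free_restr_generator (𝟙 (free C w).X),
    restr_map, restr_map]
  exact F.restr_congr (by simp only [Category.assoc, h]) rfl _

/-! ### Pullbacks, monomorphisms and covers of presheaves are pointwise -/

variable (C) in
/-- The functor sending a presheaf to its total object. -/
def total : InternalPresheaf C ⥤ E where
  obj F := F.X
  map a := a.map

lemma isPullback_map {P F G H : InternalPresheaf C} {p : P ⟶ F} {q : P ⟶ G} {a : F ⟶ H}
    {b : G ⟶ H} (h : IsPullback p q a b) : IsPullback p.map q.map a.map b.map := by
  let e := (total C).mapIso (h.isoIsPullback F G (pb_isPullback a b))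
  have h₁ : IsPullback (pullback.fst a.map b.map) (pullback.snd a.map b.map) a.map b.map :=
    IsPullback.of_hasPullback _ _
  refine h₁.of_iso e.symm (Iso.refl _) (Iso.refl _) (Iso.refl _) ?_ ?_ ?_ ?_
  · rw [Iso.refl_hom, Category.comp_id]
    exact congrArg Hom.map (h.isoIsPullback_inv_fst F G (pb_isPullback a b)).symm
  · rw [Iso.refl_hom, Category.comp_id]
    exact congrArg Hom.map (h.isoIsPullback_inv_snd F G (pb_isPullback a b)).symm
  · simp
  · simp

lemma mono_map {F G : InternalPresheaf C} (a : F ⟶ G) [Mono a] : Mono a.map :=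
  IsKernelPair.mono_of_eq_fst_snd (isPullback_map (IsKernelPair.id_of_mono a)) rfl

lemma isIso_of_isIso_map {F G : InternalPresheaf C} (a : F ⟶ G) [IsIso a.map] : IsIso a := by
  have h : inv a.map ≫ F.proj = G.proj := by rw [IsIso.inv_comp_eq, a.map_proj]
  refine ⟨⟨inv a.map, h, ?_⟩, hom_ext (IsIso.hom_inv_id a.map), hom_ext (IsIso.inv_hom_id a.map)⟩
  have h₁ : (pullback.fst G.proj C.cod ≫ inv a.map) ≫ F.proj =
      pullback.snd G.proj C.cod ≫ C.cod := by rw [Category.assoc, h, pullback.condition]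
  rw [← cancel_mono a.map, Category.assoc, IsIso.inv_hom_id, Category.comp_id]
  refine Eq.trans ?_ (restr_map a _ _ h₁).symm
  refine Eq.trans ?_ (G.restr_congr (x := pullback.fst G.proj C.cod) (by simp) rfl
    pullback.condition)
  have h₂ : pullback.lift (pullback.fst G.proj C.cod) (pullback.snd G.proj C.cod)
      pullback.condition = 𝟙 _ := by
    apply pullback.hom_ext <;> simp
  rw [restr, h₂, Category.id_comp]

lemma isCover_of_isCover_map {F G : InternalPresheaf C} {a : F ⟶ G} (h : IsCover a.map) :
    IsCover a := by
  intro M m _ g hg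
  have := mono_map m
  have := h m.map g.map (congrArg Hom.map hg)
  exact isIso_of_isIso_map m

/-- A subobject of the total object that is closed under restriction is a presheaf. -/
def ofMono (G : InternalPresheaf C) {I : E} (m : I ⟶ G.X) [Mono m]
    (act : pullback (m ≫ G.proj) C.cod ⟶ I)
    (h : act ≫ m = G.restr (pullback.fst _ _ ≫ m) (pullback.snd _ _)
      (by rw [Category.assoc, pullback.condition])) : InternalPresheaf C where
  X := I
  proj := m ≫ G.proj
  act := act
  act_proj := by rw [← Category.assoc, h, restr_proj]
  act_id := by
    rw [← cancel_mono m, Category.assoc, h, comp_restr, restr_id]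
    · simp [pullback.lift_fst_assoc]
    · simp [pullback.lift_fst_assoc, pullback.lift_snd]
  act_comp := by
    intro T x f g h₁ h₂
    have key : ∀ (y : T ⟶ I) (k : T ⟶ C.Arr) (hk : y ≫ m ≫ G.proj = k ≫ C.cod),
        (pullback.lift y k hk ≫ act) ≫ m =
          G.restr (y ≫ m) k (by rw [Category.assoc, hk]) := by
      intro y k hk
      rw [Category.assoc, h, comp_restr]
      exact G.restr_congr (pullback.lift_fst_assoc _ _ _ _) (pullback.lift_snd _ _ _) _
    rw [← cancel_mono m]
    refine (key _ _ _).trans (Eq.trans ?_ (key _ _ _).symm)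
    exact (G.restr_congr (key _ _ _) rfl _).trans
      (G.restr_restr _ _ _ (by rw [Category.assoc, h₁]) h₂)

end

variable {E : Type u} [Category.{v} E] [Regular E] {C : InternalCategory E}

/-- The image of a map of presheaves, computed on total objects. -/
lemma exists_image {F G : InternalPresheaf C} (a : F ⟶ G) :
    ∃ (I : InternalPresheaf C) (e : F ⟶ I) (m : I ⟶ G), IsCover e.map ∧ Mono m.map ∧
      e ≫ m = a := by
  obtain ⟨I, e, m, _, he, hm⟩ : ∃ (I : E) (e : F.X ⟶ I) (m : I ⟶ G.X), Mono m ∧ StrongEpi e ∧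
      e ≫ m = a.map :=
    ⟨_, (Regular.strongEpiMonoFactorisation a.map).e, (Regular.strongEpiMonoFactorisation a.map).m,
      inferInstance, inferInstance, by simp⟩
  have hp : e ≫ m ≫ G.proj = F.proj := by rw [← Category.assoc, hm, a.map_proj]
  let d : pullback F.proj C.cod ⟶ pullback (m ≫ G.proj) C.cod :=
    pullback.lift (pullback.fst _ _ ≫ e) (pullback.snd _ _)
      (by rw [Category.assoc, hp, pullback.condition])
  have hd : IsCover d := by
    refine IsCover.of_isPullback (d := pullback.fst _ _) (p := pullback.fst _ _) (f := e)
      (IsPullback.mk' (by simp [d, pullback.lift_fst]) ?_ ?_) (isCover_of_strongEpi e)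
    · intro T x y h₁ h₂
      apply pullback.hom_ext h₁
      simpa [d, pullback.lift_snd] using congrArg (· ≫ pullback.snd _ _) h₂
    · intro T x y h
      refine ⟨pullback.lift x (y ≫ pullback.snd _ _) ?_, pullback.lift_fst _ _ _, ?_⟩
      · rw [← hp, ← Category.assoc, h, Category.assoc, pullback.condition, Category.assoc]
      · apply pullback.hom_ext
        · simp [d, pullback.lift_fst, pullback.lift_fst_assoc, h]
        · simp [d, pullback.lift_snd]
  have := hd.strongEpi
  have sq : CommSq (F.act ≫ e) d m (G.restr (pullback.fst _ _ ≫ m) (pullback.snd _ _)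
      (by rw [Category.assoc, pullback.condition])) := ⟨by
    rw [Category.assoc, hm, a.map_act, comp_restr]
    exact G.restr_congr (by rw [← hm]; simp [d, pullback.lift_fst_assoc])
      (by simp [d, pullback.lift_snd]) _⟩
  refine ⟨ofMono G m sq.lift sq.fac_right, ⟨e, hp, ?_⟩, ⟨m, rfl, ?_⟩, isCover_of_strongEpi e,
    ‹Mono m›, hom_ext hm⟩
  · exact sq.fac_left.symm
  · exact sq.fac_right

lemma isCover_iff_isCover_map {F G : InternalPresheaf C} {a : F ⟶ G} :
    IsCover a ↔ IsCover a.map := by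
  refine ⟨fun h => ?_, isCover_of_isCover_map⟩
  obtain ⟨I, e, m, he, hm, rfl⟩ := exists_image a
  have : Mono m := ⟨fun f g hfg => hom_ext ((cancel_mono m.map).1 (congrArg Hom.map hfg))⟩
  have := h m e rfl
  have : IsIso m.map := (total C).map_isIso m
  exact he.comp (isCover_of_strongEpi _)

/-! ### Multi-valued sections of presheaves are pointwise -/

section Pointwise

variable {E : Type u} [Category.{v} E] [PositiveHeyting E] {S : MorphismProperty E}
  {C : InternalCategory E}

lemma pointwiseSmall_iff {F G : InternalPresheaf C} {a : F ⟶ G} :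
    pointwiseSmall S C a ↔ S a.map := Iff.rfl

lemma respectsIso_pointwiseSmall (hS : IsClassOfSmallMaps S) :
    (pointwiseSmall S C).RespectsIso :=
  have := hS.respectsIso
  { precomp := fun e he f hf => by
      have : IsIso e.map := (total C).map_isIso e
      exact (MorphismProperty.cancel_left_of_respectsIso S e.map f.map).2 hf
    postcomp := fun e he f hf => by
      have : IsIso e.map := (total C).map_isIso e
      exact (MorphismProperty.cancel_right_of_respectsIso S f.map e.map).2 hf }

lemma isMvsSpan_pointwiseSmall_iff (hS : IsClassOfSmallMaps S) {B A X Y P : InternalPresheaf C}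
    {φ : B ⟶ A} {j : A ⟶ X} {f : Y ⟶ X} {p : P ⟶ Y} {b : P ⟶ B} :
    IsMvsSpan (pointwiseSmall S C) φ j f p b ↔
      IsMvsSpan S φ.map j.map f.map p.map b.map := by
  have := hS.respectsIso
  have hpb := isPullback_map (IsPullback.of_hasPullback f j)
  have key : ∀ (w : p ≫ f = (b ≫ φ) ≫ j) (w' : p.map ≫ f.map = (b.map ≫ φ.map) ≫ j.map),
      (pullback.lift p (b ≫ φ) w).map ≫ hpb.isoPullback.hom =
        pullback.lift p.map (b.map ≫ φ.map) w' := by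
    intro w w'
    apply pullback.hom_ext
    · rw [Category.assoc, hpb.isoPullback_hom_fst, ← comp_map, pullback.lift_fst, pullback.lift_fst]
    · rw [Category.assoc, hpb.isoPullback_hom_snd, ← comp_map, pullback.lift_snd,
        pullback.lift_snd, comp_map]
  constructor
  · intro h
    have w' : p.map ≫ f.map = (b.map ≫ φ.map) ≫ j.map := congrArg Hom.map h.w
    refine ⟨w', ?_, ?_, ?_⟩
    · rw [← key h.w w']
      exact (isCover_iff_isCover_map.1 h.isCover).comp (isCover_of_strongEpi _)
    · rw [← key h.w w', MorphismProperty.cancel_right_of_respectsIso S]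
      exact h.small
    · intro T s t h₁ h₂
      have hw : p.map ≫ f.map = b.map ≫ (φ ≫ j).map := congrArg Hom.map h.w'
      have : Mono (pbLift f (φ ≫ j) p b hw) := ⟨fun x y hxy => h.jointly_mono x y
        (by
          have e := congrArg (· ≫ pbFst f (φ ≫ j)) hxy
          have e' : pbLift f (φ ≫ j) p b hw ≫ pbFst f (φ ≫ j) = p :=
            hom_ext (pullback.lift_fst _ _ _)
          simpa only [Category.assoc, e'] using e)
        (by
          have e := congrArg (· ≫ pbSnd f (φ ≫ j)) hxy
          have e' : pbLift f (φ ≫ j) p b hw ≫ pbSnd f (φ ≫ j) = b :=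
            hom_ext (pullback.lift_snd _ _ _)
          simpa only [Category.assoc, e'] using e)⟩
      have : Mono (pullback.lift p.map b.map hw) := mono_map (pbLift f (φ ≫ j) p b hw)
      rw [← cancel_mono (pullback.lift p.map b.map hw)]
      apply pullback.hom_ext
      · simpa [pullback.lift_fst] using h₁
      · simpa [pullback.lift_snd] using h₂
  · intro h
    have w : p ≫ f = (b ≫ φ) ≫ j := hom_ext h.w
    refine ⟨w, isCover_of_isCover_map ?_, ?_, fun T s t h₁ h₂ =>
      hom_ext (h.jointly_mono _ _ (congrArg Hom.map h₁) (congrArg Hom.map h₂))⟩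
    · rw [← Category.comp_id (Hom.map _), ← hpb.isoPullback.hom_inv_id, ← Category.assoc,
        key w h.w]
      exact h.isCover.comp (isCover_of_strongEpi _)
    · rw [pointwiseSmall_iff, ← MorphismProperty.cancel_right_of_respectsIso S _
        hpb.isoPullback.hom, key w h.w]
      exact h.small

end Pointwise

/-! ### The family of restrictions of an element -/

section Sharp

variable {E : Type u} [Category.{v} E] [HasPullbacks E] {C : InternalCategory E}
  {A B X : InternalPresheaf C}

/-- For `j : A ⟶ X`, the object of triples `(x, f, a)` of an element `x` of `X`, an arrow `f`
into the object below `x`, and an element `a` of `A` over `x · f`. Its fibre over `x` is the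
total object of the pullback of `A` along the map from a representable presheaf given by `x`. -/
def sharp (j : A ⟶ X) : E := pullback X.act j.map

/-- The projection `(x, f, a) ↦ x`. -/
def sharpBase (j : A ⟶ X) : sharp j ⟶ X.X := pullback.fst X.act j.map ≫ pullback.fst X.proj C.cod

/-- The projection `(x, f, a) ↦ f`. -/
def sharpArr (j : A ⟶ X) : sharp j ⟶ C.Arr := pullback.fst X.act j.map ≫ pullback.snd X.proj C.cod

/-- The projection `(x, f, a) ↦ a`. -/
def sharpElt (j : A ⟶ X) : sharp j ⟶ A.X := pullback.snd X.act j.map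

lemma sharp_condition (j : A ⟶ X) : sharpBase j ≫ X.proj = sharpArr j ≫ C.cod :=
  (Category.assoc _ _ _).trans
    ((congrArg (pullback.fst X.act j.map ≫ ·) pullback.condition).trans (Category.assoc _ _ _).symm)

lemma comp_sharp_condition (j : A ⟶ X) {T : E} (t : T ⟶ sharp j) :
    (t ≫ sharpBase j) ≫ X.proj = (t ≫ sharpArr j) ≫ C.cod := by
  rw [Category.assoc, sharp_condition, Category.assoc]

lemma comp_sharp_restr (j : A ⟶ X) {T : E} (t : T ⟶ sharp j) :
    X.restr (t ≫ sharpBase j) (t ≫ sharpArr j) (comp_sharp_condition j t) =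
      (t ≫ sharpElt j) ≫ j.map := by
  have e : pullback.lift (t ≫ sharpBase j) (t ≫ sharpArr j) (comp_sharp_condition j t) =
      t ≫ (pullback.fst X.act j.map : sharp j ⟶ _) :=
    pullback.hom_ext ((pullback.lift_fst _ _ _).trans (Category.assoc _ _ _).symm)
      ((pullback.lift_snd _ _ _).trans (Category.assoc _ _ _).symm)
  rw [restr, e]
  exact (Category.assoc _ _ _).trans
    ((congrArg (t ≫ ·) pullback.condition).trans (Category.assoc _ _ _).symm)

lemma sharpElt_proj (j : A ⟶ X) : sharpElt j ≫ A.proj = sharpArr j ≫ C.dom := by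
  have h := congrArg (· ≫ X.proj) (comp_sharp_restr j (𝟙 _))
  simpa [restr_proj, j.map_proj] using h.symm

/-- The triple `(x, f, a)`. -/
def sharpMk (j : A ⟶ X) {T : E} (x : T ⟶ X.X) (f : T ⟶ C.Arr) (a : T ⟶ A.X)
    (h : x ≫ X.proj = f ≫ C.cod) (h' : X.restr x f h = a ≫ j.map) : T ⟶ sharp j :=
  pullback.lift (pullback.lift x f h) a h'

section

variable (j : A ⟶ X) {T : E} (x : T ⟶ X.X) (f : T ⟶ C.Arr) (a : T ⟶ A.X)
    (h : x ≫ X.proj = f ≫ C.cod) (h' : X.restr x f h = a ≫ j.map)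

@[simp] lemma sharpMk_base : sharpMk j x f a h h' ≫ sharpBase j = x :=
  (pullback.lift_fst_assoc _ _ _ _).trans (pullback.lift_fst _ _ _)

@[simp] lemma sharpMk_arr : sharpMk j x f a h h' ≫ sharpArr j = f :=
  (pullback.lift_fst_assoc _ _ _ _).trans (pullback.lift_snd _ _ _)

@[simp] lemma sharpMk_elt : sharpMk j x f a h h' ≫ sharpElt j = a := pullback.lift_snd _ _ _

end

lemma sharp_ext (j : A ⟶ X) {T : E} {s t : T ⟶ sharp j} (h₁ : s ≫ sharpBase j = t ≫ sharpBase j)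
    (h₂ : s ≫ sharpArr j = t ≫ sharpArr j) (h₃ : s ≫ sharpElt j = t ≫ sharpElt j) : s = t := by
  refine pullback.hom_ext (pullback.hom_ext ?_ ?_) h₃
  · exact (Category.assoc _ _ _).trans (h₁.trans (Category.assoc _ _ _).symm)
  · exact (Category.assoc _ _ _).trans (h₂.trans (Category.assoc _ _ _).symm)

/-- The map `(x, f, b) ↦ (x, f, φ b)`. -/
def sharpMap (φ : B ⟶ A) (j : A ⟶ X) : sharp (φ ≫ j) ⟶ sharp j :=
  sharpMk j (sharpBase _) (sharpArr _) (sharpElt _ ≫ φ.map) (sharp_condition _) (by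
    have h := comp_sharp_restr (φ ≫ j) (𝟙 _)
    simpa using h)

@[simp] lemma sharpMap_base (φ : B ⟶ A) (j : A ⟶ X) :
    sharpMap φ j ≫ sharpBase j = sharpBase (φ ≫ j) := sharpMk_base _ _ _ _ _ _

@[simp] lemma sharpMap_arr (φ : B ⟶ A) (j : A ⟶ X) :
    sharpMap φ j ≫ sharpArr j = sharpArr (φ ≫ j) := sharpMk_arr _ _ _ _ _ _

@[simp] lemma sharpMap_elt (φ : B ⟶ A) (j : A ⟶ X) :
    sharpMap φ j ≫ sharpElt j = sharpElt (φ ≫ j) ≫ φ.map := sharpMk_elt _ _ _ _ _ _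

end Sharp

section SharpSmall

variable {E : Type u} [Category.{v} E] [PositiveHeyting E] {S : MorphismProperty E}
  {C : InternalCategory E} {A B X : InternalPresheaf C}

lemma small_sharpBase (hS : IsClassOfSmallMaps S) (hcod : S C.cod) {j : A ⟶ X} (hj : S j.map) :
    S (sharpBase j) :=
  hS.composition _ _ (hS.of_fst_pullback _ hj) (hS.of_fst_pullback _ hcod)

lemma small_sharpMap (hS : IsClassOfSmallMaps S) (hcod : S C.cod) {φ : B ⟶ A} {j : A ⟶ X}
    (hφ : S φ.map) (hj : S j.map) : S (sharpMap φ j) := by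
  apply hS.of_comp (g := sharpBase j)
  rw [sharpMap_base]
  exact small_sharpBase hS hcod (hS.composition _ _ hφ hj)

lemma small_freeGen (hS : IsClassOfSmallMaps S) (hcod : S C.cod) {W : E} (w : W ⟶ C.Ob) :
    S (freeGen C w) := hS.of_fst_pullback _ hcod

/-- A pointwise multi-valued section over a presheaf `Z` restricts, for a family `ζ` of elements
of `Z`, to a multi-valued section of the family of restrictions of the elements below `ζ`: its
fibre over `u` consists of the `(f, b)` with `b` in the given section over `ζ u · f`. -/
lemma exists_isMvsSpan_sharp (hS : IsClassOfSmallMaps S) {φ : B ⟶ A}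
    {j : A ⟶ X} {Z : InternalPresheaf C} {f : Z ⟶ X} {Q : E} {s : Q ⟶ Z.X} {c : Q ⟶ B.X}
    (h : IsMvsSpan S φ.map j.map f.map s c) {W : E} {w : W ⟶ C.Ob} (ζ : W ⟶ Z.X)
    (hζ : ζ ≫ Z.proj = w) {x : W ⟶ X.X} (hx : ζ ≫ f.map = x) :
    ∃ b : pullback (freeLift ζ hζ).map s ⟶ sharp (φ ≫ j),
      b ≫ sharpArr _ = pullback.fst _ _ ≫ freeArr C w ∧ b ≫ sharpElt _ = pullback.snd _ _ ≫ c ∧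
      IsMvsSpan S (sharpMap φ j) (sharpBase j) x (pullback.fst _ _ ≫ freeGen C w) b := by
  have hx' : x ≫ X.proj = w := by rw [← hx, Category.assoc, f.map_proj, hζ]
  have h₁ : (pullback.fst (freeLift ζ hζ).map s ≫ freeGen C w ≫ x) ≫ X.proj =
      (pullback.fst (freeLift ζ hζ).map s ≫ freeArr C w) ≫ C.cod := by
    simp only [Category.assoc, hx', free_condition]
  have h₂ : X.restr _ _ h₁ = (pullback.snd (freeLift ζ hζ).map s ≫ c) ≫ (φ ≫ j).map := by
    have e := congrArg (· ≫ f.map) (comp_freeLift_map ζ hζ (pullback.fst (freeLift ζ hζ).map s))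
    simp only [restr_map] at e
    refine Eq.trans (X.restr_congr (by simp only [← hx, Category.assoc]) rfl _) (e.symm.trans ?_)
    rw [Category.assoc, Category.assoc, comp_map, ← h.w', pullback.condition_assoc]
  let b := sharpMk (φ ≫ j) _ _ _ h₁ h₂
  have hb₁ : b ≫ sharpBase _ = pullback.fst _ _ ≫ freeGen C w ≫ x := sharpMk_base _ _ _ _ _ _
  have hb₂ : b ≫ sharpArr _ = pullback.fst _ _ ≫ freeArr C w := sharpMk_arr _ _ _ _ _ _
  have hb₃ : b ≫ sharpElt _ = pullback.snd _ _ ≫ c := sharpMk_elt _ _ _ _ _ _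
  clear_value b
  have wb : (pullback.fst (freeLift ζ hζ).map s ≫ freeGen C w) ≫ x =
      (b ≫ sharpMap φ j) ≫ sharpBase j := by
    rw [Category.assoc, Category.assoc, sharpMap_base, hb₁]
  -- `θ` sends `(u, (f, a))` to `(ζ u · f, a)`.
  have hθ₀ : (pullback.fst x (sharpBase j) ≫ ζ) ≫ Z.proj =
      (pullback.snd x (sharpBase j) ≫ sharpArr j) ≫ C.cod := by
    rw [← comp_sharp_condition, ← pullback.condition, Category.assoc, Category.assoc, hζ, hx']
  have hθ : Z.restr _ _ hθ₀ ≫ f.map = (pullback.snd x (sharpBase j) ≫ sharpElt j) ≫ j.map := by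
    rw [restr_map, ← comp_sharp_restr]
    exact X.restr_congr (by rw [Category.assoc, hx, pullback.condition]) rfl _
  have hpb : IsPullback (pullback.snd (freeLift ζ hζ).map s) (pullback.lift _ _ wb)
      (pullback.lift s (c ≫ φ.map) h.w) (pullback.lift _ _ hθ) := by
    refine IsPullback.mk' ?_ ?_ ?_
    · apply pullback.hom_ext
      · rw [Category.assoc, pullback.lift_fst, Category.assoc, pullback.lift_fst, comp_restr,
          ← pullback.condition, comp_freeLift_map]
        refine Z.restr_congr ?_ ?_ _
        · rw [pullback.lift_fst_assoc]
        · rw [pullback.lift_snd_assoc, Category.assoc, sharpMap_arr, hb₂]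
      · rw [Category.assoc, pullback.lift_snd, Category.assoc, pullback.lift_snd,
          pullback.lift_snd_assoc, Category.assoc, sharpMap_elt, reassoc_of% hb₃]
    · intro T a a' e₁ e₂
      refine pullback.hom_ext (free_ext ?_ ?_) e₁
      · simpa [pullback.lift_fst] using congrArg (· ≫ pullback.fst _ _) e₂
      · simpa [pullback.lift_snd_assoc, hb₂] using congrArg (· ≫ pullback.snd _ _ ≫ sharpArr j) e₂
    · intro T a d e
      have e₁ := congrArg (· ≫ pullback.fst _ _) e
      have e₂ := congrArg (· ≫ pullback.snd _ _) e
      simp only [Category.assoc, pullback.lift_fst, pullback.lift_snd] at e₁ e₂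
      have hm : (d ≫ pullback.fst x (sharpBase j)) ≫ w =
          (d ≫ pullback.snd x (sharpBase j) ≫ sharpArr j) ≫ C.cod := by
        rw [← hx', ← Category.assoc _ x, Category.assoc d, pullback.condition]
        simp only [Category.assoc, sharp_condition]
      refine ⟨pullback.lift (freeMk _ _ hm) a ?_, pullback.lift_snd _ _ _, ?_⟩
      · rw [comp_freeLift_map, e₁, comp_restr]
        exact Z.restr_congr (by rw [freeMk_gen, Category.assoc]) (by rw [freeMk_arr]) _
      · apply pullback.hom_ext
        · simp [pullback.lift_fst, pullback.lift_fst_assoc]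
        · simp only [Category.assoc, pullback.lift_snd]
          apply sharp_ext
          · simp [hb₁, pullback.lift_fst_assoc, reassoc_of% (freeMk_gen _ _ hm), pullback.condition]
          · simp [hb₂, pullback.lift_fst_assoc]
          · simp [reassoc_of% hb₃, pullback.lift_snd_assoc, e₂]
  refine ⟨b, hb₂, hb₃, wb, IsCover.of_isPullback hpb h.isCover,
    hS.pullback_stability hpb h.small, ?_⟩
  intro T a a' e₁ e₂
  have e₃ : a ≫ pullback.fst _ _ = a' ≫ pullback.fst _ _ := by
    apply free_ext
    · simpa using e₁
    · simpa [hb₂] using congrArg (· ≫ sharpArr _) e₂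
  refine pullback.hom_ext e₃ (h.jointly_mono _ _ ?_ ?_)
  · simp only [Category.assoc, ← pullback.condition]
    rw [← Category.assoc, e₃, Category.assoc]
  · simpa [hb₃] using congrArg (· ≫ sharpElt _) e₂

end SharpSmall

/-! ### The presheaf generated by a multi-valued section -/

section Generate

variable {E : Type u} [Category.{v} E] [PositiveHeyting E] {S : MorphismProperty E}
  {C : InternalCategory E} {A B X : InternalPresheaf C}

lemma generator_proj {j : A ⟶ X} {P₀ W : E} {x : W ⟶ X.X} {w : W ⟶ C.Ob} (hx : x ≫ X.proj = w)
    {p₀ : P₀ ⟶ W} {b₀ : P₀ ⟶ sharp j} (h : p₀ ≫ x = b₀ ≫ sharpBase j) :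
    p₀ ≫ w = (b₀ ≫ sharpArr j) ≫ C.cod := by
  rw [← comp_sharp_condition, ← h, ← hx, Category.assoc]

/-- A multi-valued section `P₀` of the family of restrictions, over an element `x : W ⟶ X`,
generates a pointwise multi-valued section `P` over the presheaf freely generated by `W`: the image
of the map from the free presheaf on `P₀` sending a generator `(u, (f, b))` to `((u, f), b)`. -/
lemma exists_isMvsSpan_of_sharp (hS : IsClassOfSmallMaps S) (hcod : S C.cod) {φ : B ⟶ A}
    {j : A ⟶ X} (hj : S j.map) {W P₀ : E} {w : W ⟶ C.Ob} (x : W ⟶ X.X) (hx : x ≫ X.proj = w)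
    {p₀ : P₀ ⟶ W} {b₀ : P₀ ⟶ sharp (φ ≫ j)}
    (h : IsMvsSpan S (sharpMap φ j) (sharpBase j) x p₀ b₀)
    (h₀ : p₀ ≫ w = (b₀ ≫ sharpArr (φ ≫ j)) ≫ C.cod)
    {v : P₀ ⟶ C.Ob} (hv : (b₀ ≫ sharpArr (φ ≫ j)) ≫ C.dom = v) :
    ∃ (P : InternalPresheaf C) (e : free C v ⟶ P) (p : P ⟶ free C w) (b : P ⟶ B),
      IsCover e.map ∧ freeUnit C v ≫ e.map ≫ p.map = freeMk p₀ _ h₀ ∧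
      freeUnit C v ≫ e.map ≫ b.map = b₀ ≫ sharpElt _ ∧
      IsMvsSpan S φ.map j.map (freeLift x hx).map p.map b.map := by
  have hb₀ : p₀ ≫ x = b₀ ≫ sharpBase (φ ≫ j) := by
    rw [h.w, Category.assoc, sharpMap_base]
  have hs : freeMk p₀ _ h₀ ≫ (freeLift x hx).map = (b₀ ≫ sharpElt _) ≫ (φ ≫ j).map := by
    rw [comp_freeLift_map, ← comp_sharp_restr]
    exact X.restr_congr (by rw [freeMk_gen, hb₀]) (freeMk_arr _ _ _) _
  obtain ⟨I, e, m, he, hm, hem⟩ := exists_image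
    (freeLift (C := C) (F := pb (freeLift x hx) (φ ≫ j)) (w := v) (pullback.lift _ _ hs) (by
      refine (pullback.lift_fst_assoc _ _ _ _).trans ?_
      rw [free_proj, ← Category.assoc, freeMk_arr, hv]))
  have hu : freeUnit C v ≫ e.map ≫ m.map = pullback.lift _ _ hs := by
    rw [← comp_map, hem]
    exact freeUnit_freeLift _ _
  have hp : freeUnit C v ≫ e.map ≫ (m ≫ pbFst _ _).map = freeMk p₀ _ h₀ := by
    rw [comp_map, reassoc_of% hu]
    exact pullback.lift_fst _ _ _
  have hb : freeUnit C v ≫ e.map ≫ (m ≫ pbSnd _ _).map = b₀ ≫ sharpElt _ := by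
    rw [comp_map, reassoc_of% hu]
    exact pullback.lift_snd _ _ _
  have hjm : ∀ ⦃T : E⦄ (s t : T ⟶ I.X), s ≫ (m ≫ pbFst (freeLift x hx) (φ ≫ j)).map =
      t ≫ (m ≫ pbFst (freeLift x hx) (φ ≫ j)).map →
      s ≫ (m ≫ pbSnd (freeLift x hx) (φ ≫ j)).map =
      t ≫ (m ≫ pbSnd (freeLift x hx) (φ ≫ j)).map → s = t := by
    intro T s t h₁ h₂
    rw [← cancel_mono m.map]
    exact pullback.hom_ext ((Category.assoc _ _ _).trans (h₁.trans (Category.assoc _ _ _).symm))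
      ((Category.assoc _ _ _).trans (h₂.trans (Category.assoc _ _ _).symm))
  have hw : (m ≫ pbFst _ _).map ≫ (freeLift x hx).map =
      ((m ≫ pbSnd (freeLift x hx) (φ ≫ j)).map ≫ φ.map) ≫ j.map := by
    rw [Category.assoc, ← comp_map φ j, ← comp_map, ← comp_map, Category.assoc, Category.assoc,
      (pb_isPullback (freeLift x hx) (φ ≫ j)).w]
  refine ⟨I, e, m ≫ pbFst _ _, m ≫ pbSnd _ _, he, hp, hb, hw, ?_, ?_, hjm⟩
  · -- The generators `(u, f, b)` already cover the pairs of an element `(u, f)` and an `a` below.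
    have hδ : freeMk p₀ _ h₀ ≫ (freeLift x hx).map = (b₀ ≫ sharpElt _ ≫ φ.map) ≫ j.map := by
      rw [hs]; simp only [Category.assoc, comp_map]
    have hδ' : (freeUnit C v ≫ e.map) ≫ pullback.lift _ _ hw = pullback.lift _ _ hδ := by
      apply pullback.hom_ext
      · rw [Category.assoc, pullback.lift_fst, Category.assoc, hp, pullback.lift_fst]
      · simp only [Category.assoc, pullback.lift_snd, reassoc_of% hb]
    have hδc : IsCover (pullback.lift _ _ hδ) := by
      let D := pullback (freeLift x hx).map j.map
      have k₁ : ((pullback.fst _ _ : D ⟶ _) ≫ freeGen C w ≫ x) ≫ X.proj =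
          ((pullback.fst _ _ : D ⟶ _) ≫ freeArr C w) ≫ C.cod := by
        simp only [Category.assoc, hx, free_condition]
      have k₂ : X.restr _ _ k₁ = (pullback.snd _ _ : D ⟶ _) ≫ j.map := by
        rw [← pullback.condition, comp_freeLift_map]
        exact X.restr_congr (Category.assoc _ _ _).symm rfl _
      have k₃ : ((pullback.fst _ _ : D ⟶ _) ≫ freeGen C w) ≫ x =
          sharpMk j _ _ _ k₁ k₂ ≫ sharpBase j := by
        rw [sharpMk_base, Category.assoc]
      -- The map from `D`, sending `((u, f), a)` to `(u, (f, a))`, is monic, and it carries the map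
      -- from `P₀` to `D` to the cover that makes `P₀` a multi-valued section.
      have hpb : IsPullback (𝟙 P₀) (pullback.lift _ _ hδ)
          (pullback.lift _ _ h.w) (pullback.lift _ _ k₃) := by
        have comm : pullback.lift _ _ h.w = pullback.lift _ _ hδ ≫ pullback.lift _ _ k₃ := by
          apply pullback.hom_ext
          · simp [pullback.lift_fst, pullback.lift_fst_assoc]
          · simp only [Category.assoc, pullback.lift_snd]
            apply sharp_ext
            · simp [pullback.lift_fst_assoc, reassoc_of% (freeMk_gen p₀ _ h₀), hb₀]
            · simp [pullback.lift_fst_assoc]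
            · simp [pullback.lift_snd]
        have hmono : Mono (pullback.lift _ _ k₃) := ⟨fun s t hst => by
          have e₁ := congrArg (· ≫ pullback.fst _ _) hst
          have e₂ := congrArg (· ≫ pullback.snd _ _ ≫ sharpArr j) hst
          have e₃ := congrArg (· ≫ pullback.snd _ _ ≫ sharpElt j) hst
          simp only [Category.assoc, pullback.lift_fst, pullback.lift_snd_assoc, sharpMk_arr,
            sharpMk_elt] at e₁ e₂ e₃
          exact pullback.hom_ext (free_ext (by simpa using e₁) (by simpa using e₂)) e₃⟩
        refine IsPullback.mk' (by rw [Category.id_comp, comm]) (fun T s t h₁ _ => by simpa using h₁)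
          fun T s t hst => ⟨s, Category.comp_id s, ?_⟩
        rw [← cancel_mono (pullback.lift _ _ k₃), Category.assoc, ← comm, hst]
      exact IsCover.of_isPullback hpb h.isCover
    rw [← hδ'] at hδc
    exact hδc.of_comp
  · -- By the quotient axiom and cancellation it suffices that the free presheaf on `P₀` is small
    -- over `W`.
    refine hS.quotients e.map _ he (hS.of_comp (g := pullback.fst _ _ ≫ freeGen C w) ?_)
    have e₁ : (e.map ≫ pullback.lift _ _ hw) ≫ pullback.fst _ _ ≫ freeGen C w =
        freeGen C v ≫ p₀ := by
      have e₂ : e ≫ m ≫ pbFst _ _ = freeLift (freeMk p₀ _ h₀) (by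
          rw [free_proj, ← Category.assoc, freeMk_arr, hv]) :=
        free_hom_ext (by rw [freeUnit_freeLift, comp_map, hp])
      rw [Category.assoc, pullback.lift_fst_assoc, ← Category.assoc, ← comp_map, e₂, freeLift,
        free_restr_gen, Category.assoc, freeMk_gen]
    rw [e₁]
    have hp₀ : S p₀ := by
      rw [← pullback.lift_fst p₀ (b₀ ≫ sharpMap φ j) h.w]
      exact hS.composition _ _ h.small (hS.of_fst_pullback _ (small_sharpBase hS hcod hj))
    exact hS.composition _ _ (small_freeGen hS hcod _) hp₀

end Generate

/-! ### Fullness for presheaves -/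

section Main

variable {E : Type u} [Category.{v} E] [PositiveHeyting E] {S : MorphismProperty E}
  {C : InternalCategory E}

/-- A quasi-pullback of the object of pairs `(x, f)` along `h : B' ⟶ X` covers the presheaf freely
generated by `B'`. -/
lemma isCover_freeMk_of_isQuasiPullback {X : InternalPresheaf C} {Z' B' : E} {g : Z' ⟶ B'}
    {h : B' ⟶ X.X} {t : Z' ⟶ pullback X.proj C.cod}
    (hsq : IsQuasiPullback t g (pullback.fst X.proj C.cod) h)
    (hr : g ≫ h ≫ X.proj = (t ≫ pullback.snd _ _) ≫ C.cod) :
    IsCover (freeMk (w := h ≫ X.proj) g (t ≫ pullback.snd _ _) hr) := by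
  obtain ⟨hc, hcov⟩ := hsq
  have hθ : pullback.fst h (pullback.fst X.proj C.cod) ≫ h ≫ X.proj =
      (pullback.snd h (pullback.fst X.proj C.cod) ≫ pullback.snd _ _) ≫ C.cod := by
    rw [pullback.condition_assoc, pullback.condition, Category.assoc]
  have hθ' : freeGen C (h ≫ X.proj) ≫ h = pullback.lift (freeGen C (h ≫ X.proj) ≫ h)
      (freeArr C (h ≫ X.proj)) (by rw [Category.assoc, free_condition]) ≫
        pullback.fst X.proj C.cod := (pullback.lift_fst _ _ _).symm
  have hsplit : IsSplitEpi (freeMk (w := h ≫ X.proj) _ _ hθ) := ⟨⟨pullback.lift _ _ hθ', by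
    apply free_ext
    · simp [pullback.lift_fst]
    · simp [pullback.lift_snd_assoc, pullback.lift_snd]⟩⟩
  have e : freeMk (w := h ≫ X.proj) g (t ≫ pullback.snd _ _) hr =
      pullback.lift g t hc ≫ freeMk (w := h ≫ X.proj) _ _ hθ := by
    apply free_ext
    · simp [pullback.lift_fst]
    · simp [pullback.lift_snd_assoc]
  rw [e]
  exact hcov.comp (isCover_of_strongEpi _)

lemma freeLift_freeUnit_arr {W V : E} {w : W ⟶ C.Ob} {v : V ⟶ C.Ob} (κ : V ⟶ W)
    (h : (κ ≫ freeUnit C w) ≫ (free C w).proj = v) :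
    (freeLift (κ ≫ freeUnit C w) h).map ≫ freeArr C w = freeArr C v := by
  rw [freeLift, free_restr_arr]
  apply C.ident_compose
  rw [← Category.assoc _ C.cod, ← free_condition, ← h]
  simp only [Category.assoc, freeUnit_arr, freeUnit_proj]

/-- A map on total objects is a map of presheaves if its composites with a jointly monic pair of
maps of presheaves are. -/
lemma exists_hom_of_jointly_mono {T Q Z B : InternalPresheaf C} {s : Q ⟶ Z} {c : Q ⟶ B}
    (hsc : ∀ ⦃W : E⦄ (a b : W ⟶ Q.X), a ≫ s.map = b ≫ s.map → a ≫ c.map = b ≫ c.map → a = b)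
    {x : T ⟶ Z} {y : T ⟶ B} {τ : T.X ⟶ Q.X} (hs : τ ≫ s.map = x.map) (hc : τ ≫ c.map = y.map) :
    ∃ t : T ⟶ Q, t ≫ s = x ∧ t ≫ c = y := by
  have hp : τ ≫ Q.proj = T.proj := by rw [← s.map_proj, reassoc_of% hs, x.map_proj]
  have hp' : (pullback.fst T.proj C.cod ≫ τ) ≫ Q.proj = pullback.snd T.proj C.cod ≫ C.cod := by
    rw [Category.assoc, hp, pullback.condition]
  refine ⟨⟨τ, hp, hsc _ (Q.restr _ _ hp') ?_ ?_⟩, hom_ext hs, hom_ext hc⟩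
  · rw [Category.assoc, hs, x.map_act, restr_map]
    exact Z.restr_congr (by rw [Category.assoc, hs]) rfl _
  · rw [Category.assoc, hc, y.map_act, restr_map]
    exact B.restr_congr (by rw [Category.assoc, hc]) rfl _

/-- Fullness is inherited by presheaves with pointwise small maps. -/
theorem spanFullness_pointwiseSmall (hS : IsClassOfSmallMaps S) (hcod : S C.cod)
    (hF : SpanFullness S) : SpanFullness (pointwiseSmall S C) := by
  intro B A X φ j hφ hj
  obtain ⟨X₁, M, PM, q₁, y₁, pM, bM, hq₁, hy₁, hM, HM⟩ :=
    hF (sharpMap φ j) (sharpBase j) (small_sharpMap hS hcod hφ hj) (small_sharpBase hS hcod hj)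
  -- Elements of `pullback X.act q₁` are pairs `(x, f)` with a lift of `x · f` to `X₁`.
  have hW : IsCover (pullback.fst X.act q₁) :=
    IsCover.of_isPullback (IsPullback.of_hasPullback X.act q₁).flip hq₁
  obtain ⟨Z', B', t, g, h, hg, hsq, hh⟩ :=
    hS.collection (pullback.fst X.act q₁) (pullback.fst X.proj C.cod) hW
      (hS.of_fst_pullback _ hcod)
  have hgh : g ≫ h = (t ≫ pullback.fst X.act q₁) ≫ pullback.fst X.proj C.cod := hsq.1
  have hr : g ≫ h ≫ X.proj = ((t ≫ pullback.fst X.act q₁) ≫ pullback.snd _ _) ≫ C.cod := by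
    rw [reassoc_of% hgh, pullback.condition]; simp only [Category.assoc]
  have hrc := isCover_freeMk_of_isQuasiPullback hsq hr
  have hrg : freeMk (w := h ≫ X.proj) _ _ hr ≫ freeGen C _ = g := freeMk_gen _ _ _
  -- `q` sends `(u, f)` to `h u · f`.
  let q : free C (h ≫ X.proj) ⟶ X := freeLift h rfl
  have hq : IsCover q.map := by
    refine IsCover.of_comp (f := freeUnit C _) ?_
    rw [freeUnit_freeLift]
    exact hh
  have hz : (t ≫ pullback.snd X.act q₁) ≫ q₁ = freeMk (w := h ≫ X.proj) _ _ hr ≫ q.map := by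
    rw [comp_freeLift_map, Category.assoc, ← pullback.condition, restr, ← Category.assoc]
    congr 1
    apply pullback.hom_ext
    · rw [pullback.lift_fst, freeMk_gen, hgh]
    · rw [pullback.lift_snd, freeMk_arr]
  -- Collection is used in this form: the cover `r : Z' ⟶ X'` sends an element of `Z'` to its pair
  -- `(u, f)`, and `z₁` lifts the image of `r` in `X` to `X₁`.
  generalize freeMk (w := h ≫ X.proj) _ _ hr = r at hrc hrg hz
  generalize t ≫ pullback.snd X.act q₁ = z₁ at hz
  -- The generators of `Y` are the pairs of elements of `M` and `Z'` over the same element of `X₁`.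
  let m₀ : pullback y₁ z₁ ⟶ M := pullback.fst y₁ z₁
  let t₀ : pullback y₁ z₁ ⟶ Z' := pullback.snd y₁ z₁
  have hmt : m₀ ≫ y₁ = t₀ ≫ z₁ := pullback.condition
  have ht₀ : S t₀ := hS.of_snd_pullback _ hy₁
  have hMY := hM.baseChange hS m₀ (f' := (t₀ ≫ r) ≫ q.map)
    (by rw [reassoc_of% hmt, hz, Category.assoc])
  have hMb : pullback.snd pM m₀ ≫ (t₀ ≫ r) ≫ q.map =
      (pullback.fst pM m₀ ≫ bM) ≫ sharpBase (φ ≫ j) := by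
    rw [hMY.w, Category.assoc, sharpMap_base]
  -- The maps to the object of objects get names of their own, as the types of the free presheaves
  -- depend on them.
  obtain ⟨w₀, hw₀⟩ : ∃ w₀, ((t₀ ≫ r) ≫ q.map) ≫ X.proj = w₀ := ⟨_, rfl⟩
  obtain ⟨v, hv⟩ : ∃ v, ((pullback.fst pM m₀ ≫ bM) ≫ sharpArr (φ ≫ j)) ≫ C.dom = v := ⟨_, rfl⟩
  have hw : (t₀ ≫ r) ≫ (free C (h ≫ X.proj)).proj = w₀ := by
    rw [← hw₀, Category.assoc _ q.map, q.map_proj]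
  have hM₀ := generator_proj hw₀ hMb
  obtain ⟨P, e, p, b, he, hep, heb, hP⟩ := exists_isMvsSpan_of_sharp hS hcod hj _ hw₀ hMY hM₀ hv
  have hy : S (freeLift (t₀ ≫ r) hw).map := by
    -- By cancellation it suffices that `Y ⟶ B'` is small.
    refine hS.of_comp (g := freeGen C _) ?_
    have e₁ : (freeLift (t₀ ≫ r) hw).map ≫ freeGen C _ = freeGen C w₀ ≫ t₀ ≫ g := by
      rw [freeLift, free_restr_gen, ← hrg]; simp only [Category.assoc]
    rw [e₁]
    exact hS.composition _ _ (small_freeGen hS hcod _) (hS.composition _ _ ht₀ hg)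
  have hyq : freeLift (t₀ ≫ r) hw ≫ q = freeLift ((t₀ ≫ r) ≫ q.map) hw₀ :=
    free_hom_ext (by rw [freeUnit_freeLift, comp_map, ← Category.assoc, freeUnit_freeLift])
  refine ⟨_, _, P, q, freeLift (t₀ ≫ r) hw, p, b, isCover_of_isCover_map hq, hy, ?_, ?_⟩
  · rw [hyq, isMvsSpan_pointwiseSmall_iff hS]
    exact hP
  intro Z Q z s c hQ
  rw [isMvsSpan_pointwiseSmall_iff hS] at hQ
  -- Fullness in `E` is applied to the restriction of `Q` to the pairs of elements of `Z` and `Z'`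
  -- over the same element of `X'`.
  have hzc : IsCover (pullback.fst z.map r) :=
    IsCover.of_isPullback (IsPullback.of_hasPullback z.map r).flip hrc
  obtain ⟨wζ, hwζ⟩ : ∃ wζ, pullback.fst z.map r ≫ Z.proj = wζ := ⟨_, rfl⟩
  obtain ⟨bQ, hbQ₁, hbQ₂, hQE⟩ := exists_isMvsSpan_sharp hS hQ (pullback.fst z.map r) hwζ
    (x := (pullback.snd z.map r ≫ z₁) ≫ q₁) (by
      rw [comp_map, pullback.condition_assoc, Category.assoc, hz])
  obtain ⟨U, k, l, hkl, hl, HU⟩ := HM _ _ _ hQE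
  have hκ : k ≫ y₁ = (l ≫ pullback.snd z.map r) ≫ z₁ := by rw [hkl, Category.assoc]
  let κ : U ⟶ pullback y₁ z₁ := pullback.lift k _ hκ
  have hκm : κ ≫ m₀ = k := pullback.lift_fst _ _ _
  have hκt : κ ≫ t₀ = l ≫ pullback.snd z.map r := pullback.lift_snd _ _ _
  have hκr : κ ≫ t₀ ≫ r = (l ≫ pullback.fst z.map r) ≫ z.map := by
    rw [reassoc_of% hκt, ← pullback.condition, Category.assoc]
  -- The cover of `Z` is the free presheaf on `U`; its map to `Y` sends `u` to the generator `κ u`.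
  obtain ⟨wU, hwU⟩ : ∃ wU, κ ≫ w₀ = wU := ⟨_, rfl⟩
  have hl' : (l ≫ pullback.fst z.map r) ≫ Z.proj = wU := by
    rw [← hwU, ← hw, ← Category.assoc, hκr, Category.assoc _ z.map, z.map_proj]
  have hk' : (κ ≫ freeUnit C w₀) ≫ (free C w₀).proj = wU := by
    rw [Category.assoc, freeUnit_proj, hwU]
  refine ⟨free C wU, freeLift _ hk', freeLift _ hl', ?_, ?_, ?_⟩
  · apply free_hom_ext
    rw [comp_map, comp_map, ← Category.assoc, ← Category.assoc, freeUnit_freeLift,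
      freeUnit_freeLift, Category.assoc, freeUnit_freeLift, hκr]
  · refine isCover_of_isCover_map (IsCover.of_comp (f := freeUnit C _) ?_)
    rw [freeUnit_freeLift]
    exact hl.comp hzc
  intro T m ρ hρ
  -- Locally `ρ` is the restriction along `ρ' ≫ freeArr` of a generator of `P`.
  let σ := pullback.fst ρ.map e.map
  let ρ' := pullback.snd ρ.map e.map
  have hσ : IsCover σ := IsCover.of_isPullback (IsPullback.of_hasPullback ρ.map e.map).flip he
  have hσρ : σ ≫ ρ.map = ρ' ≫ e.map := pullback.condition
  have hep' : e ≫ p = freeLift (freeMk _ _ hM₀)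
      (by rw [free_proj, ← Category.assoc, freeMk_arr, hv]) :=
    free_hom_ext (by rw [freeUnit_freeLift, comp_map, hep])
  have heb' : e ≫ b = freeLift ((pullback.fst pM m₀ ≫ bM) ≫ sharpElt _)
      (by rw [Category.assoc, sharpElt_proj, ← Category.assoc, hv]) :=
    free_hom_ext (by rw [freeUnit_freeLift, comp_map, heb])
  have hρ' : ρ' ≫ (e ≫ p).map = (σ ≫ m.map) ≫ (freeLift _ hk').map := by
    rw [comp_map, ← Category.assoc, ← hσρ, Category.assoc, ← comp_map, hρ, comp_map,
      Category.assoc]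
  have hgen : (ρ' ≫ freeGen C v) ≫ pullback.snd pM m₀ = ((σ ≫ m.map) ≫ freeGen C wU) ≫ κ := by
    have e₁ := congrArg (· ≫ freeGen C w₀) hρ'
    simp only [hep', comp_freeLift_map, free_restr_gen, Category.assoc, freeMk_gen,
      freeUnit_gen, Category.comp_id] at e₁
    simpa only [Category.assoc] using e₁
  have hkG : ((ρ' ≫ freeGen C v) ≫ (pullback.fst pM m₀ ≫ bM) ≫ sharpArr _) ≫ C.dom =
      (ρ' ≫ freeArr C v) ≫ C.cod := by
    rw [Category.assoc, hv, Category.assoc, free_condition, Category.assoc]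
  have harr : C.compose _ _ hkG = (σ ≫ m.map) ≫ freeArr C wU := by
    have e₁ := congrArg (· ≫ freeArr C w₀) hρ'
    simp only [Category.assoc, freeLift_freeUnit_arr] at e₁
    have e₂ := (congrArg (ρ' ≫ Hom.map ·) hep').trans (comp_freeLift_map _ _ _)
    refine Eq.trans ?_ ((congrArg (· ≫ freeArr C w₀) e₂).symm.trans
      ((Category.assoc _ _ _).trans (e₁.trans (Category.assoc _ _ _).symm)))
    refine Eq.trans ?_ (free_restr_arr _ _ _).symm
    exact C.compose_congr (by rw [Category.assoc (ρ' ≫ _), freeMk_arr]) rfl _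
  -- The generator below `ρ` lies in `Q`; its restriction along `ρ' ≫ freeArr` is the required lift.
  obtain ⟨t', ht₁, ht₂⟩ := HU ((σ ≫ m.map) ≫ freeGen C wU)
    ((ρ' ≫ freeGen C v) ≫ pullback.fst pM m₀) (by
      rw [Category.assoc, pullback.condition, ← Category.assoc, hgen, Category.assoc, hκm])
  have hτs : (t' ≫ pullback.snd _ _) ≫ s.map =
      Z.restr (((σ ≫ m.map) ≫ freeGen C wU) ≫ l ≫ pullback.fst z.map r)
        ((ρ' ≫ freeGen C v) ≫ (pullback.fst pM m₀ ≫ bM) ≫ sharpArr _) (by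
          rw [Category.assoc, hl', Category.assoc, free_condition, ← Category.assoc, ← harr,
            C.compose_cod]) := by
    rw [Category.assoc, ← pullback.condition, ← Category.assoc, comp_freeLift_map]
    refine Z.restr_congr ?_ ?_ _
    · rw [Category.assoc t', ht₁, Category.assoc]
    · rw [Category.assoc, ← hbQ₁, ← Category.assoc, ht₂]
      simp only [Category.assoc]
  have hτp : (t' ≫ pullback.snd _ _) ≫ Q.proj = (ρ' ≫ freeArr C v) ≫ C.cod := by
    rw [← s.map_proj, ← Category.assoc, hτs, restr_proj, hkG]
  obtain ⟨τ, hτ₁, hτ₂⟩ := hσ.exists_lift_pair hQ.jointly_mono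
    (x := m.map ≫ (freeLift _ hl').map) (y := ρ.map ≫ b.map) (t := Q.restr _ _ hτp) (by
      have e₁ := comp_freeLift_map _ hl' (σ ≫ m.map)
      rw [Category.assoc] at e₁
      rw [restr_map, e₁]
      refine (Z.restr_congr hτs rfl _).trans ((Z.restr_restr _ _ _ _ hkG).trans ?_)
      exact Z.restr_congr rfl harr _) (by
      have e₁ : σ ≫ ρ.map ≫ b.map = ρ' ≫ (e ≫ b).map := by
        rw [comp_map, ← Category.assoc, hσρ, Category.assoc]
      rw [restr_map, e₁, heb', comp_freeLift_map]
      refine B.restr_congr ?_ rfl _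
      rw [Category.assoc, ← hbQ₂, ← Category.assoc, ht₂]
      simp only [Category.assoc])
  exact exists_hom_of_jointly_mono hQ.jointly_mono hτ₁ hτ₂

end Main

end InternalPresheaf

end SmallMaps

end

theorem mainTheorem4 {E : Type u} [Category.{v} E] [SmallMaps.PositiveHeyting E]
    (S : MorphismProperty E) (hS : SmallMaps.IsPredicative S)
    (C : SmallMaps.InternalCategory E) (hcod : S C.cod) (hF : SmallMaps.Fullness S) :
    (Nonempty C.ChosenPullbacks →
      SmallMaps.Fullness (SmallMaps.InternalPresheaf.pointwiseSmall S C)) ∧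
    (Nonempty C.ChosenFiniteProducts →
      SmallMaps.Fullness (SmallMaps.InternalPresheaf.pointwiseSmall S C)) := by
  have hS' := hS.toIsClassOfSmallMaps
  have := hS'.respectsIso
  have := SmallMaps.InternalPresheaf.respectsIso_pointwiseSmall (C := C) hS'
  have h := (SmallMaps.InternalPresheaf.spanFullness_pointwiseSmall hS' hcod
    hF.spanFullness).fullness
  exact ⟨fun _ => h, fun _ => h⟩
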